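/- Graphs are finite, nonempty and undirected, possibly with multiple edges and multiple loops; each edge (loops included) corresponds to two distinct directed edges, mutually inverse, the inverse of $e$ being written $\overline{e}$. The degree of a vertex is the number of directed edges with origin at it, and the entry $A_{ab}$ of the adjacency matrix $A$ is the number of directed edges from $a$ to $b$. A walk of length $r$ is a sequence of vertices $v_0,\dots,v_r$ and directed edges $e_0,\dots,e_{r-1}$ with $e_i$ going from $v_i$ to $v_{i+1}$; it is closed if $v_0=v_r$, and non-backtracking if $e_i\ne\overline{e_{i+1}}$ for $0\le i\le r-2$. A circuit is a closed non-backtracking walk of length $r\ge1$ with $e_0\neq\overline{e_{r-1}}$. Let $f_r(G)$ be the number of closed non-backtracking walks of length $r$ in $G$, and $c_r(G)$ the number of circuits of length $r$ in $G$. For a $(q+1)$-regular graph $G=(V,E)$, $q\ge 1$, whose adjacency matrix has eigenvalues $\lambda_1,\dots,\lambda_{|V|}$ (with multiplicity), the normalized spectral measure is $\mu(G)=\frac1{|V|}\sum_{k}\delta_{q^{-1/2}\lambda_k}$. Let $\mu_\infty$ be the semicircle law, $d\mu_\infty(x)=\frac1{2\pi}\sqrt{4-x^2}\,\mathbf 1_{|x|\le2}\,dx$.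 For $p\in[1,\infty)$ let $P_p(\mathbb R)$ be the space of probability measures on $\mathbb R$ with finite $p$-th absolute moment, with the Wasserstein metric $W_p(\mu,\nu)=\inf_{\gamma}\left(\int|x-y|^p\,d\gamma(x,y)\right)^{1/p}$, the infimum being over all couplings $\gamma$ of $\mu$ and $\nu$; and let $F_\mu^{-1}(x)=\inf\{y:\mu((-\infty,y])\ge x\}$. **Lemma 4.2.** Let $G_n=(V_n,E_n)$ be a sequence of $(q_n+1)$-regular graphs, $q_n\in\mathbb N$, $q_n\ge1$, with normalized spectral measures $\mu_n=\mu(G_n)$, and suppose that $\mu_n$ converges weakly to $\mu_\infty$ as $n\to\infty$. Let $m\ge 1$ be an even integer. Then the following are equivalent: (i) for every real $p\in[1,m]$, $\mu_n\to\mu_\infty$ in $(P_p(\mathbb R),W_p)$ as $n\to\infty$; (ii) for every real $p\in[1,m]$, $F_{\mu_n}^{-1}\to F_{\mu_\infty}^{-1}$ in $L^p[0,1]$ as $n\to\infty$; (iii) $q_n\to\infty$ and, for every $r\in\{1,\dots,m\}$, $q_n^{-r/2}\,\dfrac{c_r(G_n)}{|V_n|}\to0$ as $n\to\infty$; (iv)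 $q_n\to\infty$ and, for every $r\in\{1,\dots,m\}$, $q_n^{-r/2}\,\dfrac{f_r(G_n)}{|V_n|}\to0$ as $n\to\infty$. -/

import Mathlib

open MeasureTheory Filter Topology
open scoped ENNReal

/-- An undirected graph with vertex type `V`, possibly with multiple edges and multiple loops,
given by its set `D` of directed edges: every undirected edge (loops included) corresponds to two
distinct directed edges `d` and `rev d`, and `org d` is the origin of `d`. -/
structure Multigraph (V : Type*) (D : Type*) where
  org : D → V
  rev : D → D
  rev_rev : ∀ d, rev (rev d) = d
  rev_ne : ∀ d, rev d ≠ d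

namespace Multigraph

variable {V D : Type*} (G : Multigraph V D)

/-- The terminus of a directed edge. -/
def ter (d : D) : V := G.org (G.rev d)

/-- Every vertex has degree `k` (a loop contributes two to the degree of its vertex). -/
def IsRegular (k : ℕ) : Prop := ∀ v : V, Nat.card {d : D // G.org d = v} = k

/-- A walk of length `n`: vertices `v₀, …, vₙ` and directed edges `e₀, …, eₙ₋₁` such that `eᵢ` goes
from `vᵢ` to `vᵢ₊₁`. -/
structure Walk (n : ℕ) where
  vert : Fin (n + 1) → V
  edge : Fin n → D
  org_edge : ∀ i : Fin n, vert i.castSucc = G.org (edge i)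
  ter_edge : ∀ i : Fin n, vert i.succ = G.ter (edge i)

variable {G}

/-- A walk is closed if it ends at its initial vertex. -/
def Walk.IsClosed {n : ℕ} (w : G.Walk n) : Prop := w.vert 0 = w.vert (Fin.last n)

/-- No directed edge of the walk is immediately followed by its inverse. -/
def Walk.IsNonBacktracking {n : ℕ} (w : G.Walk n) : Prop :=
  ∀ i j : Fin n, (j : ℕ) = (i : ℕ) + 1 → w.edge i ≠ G.rev (w.edge j)

/-- A circuit: a closed non-backtracking walk of positive length whose first directed edge is not
the inverse of the last one. -/
def Walk.IsCircuit {n : ℕ} (w : G.Walk n) : Prop :=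
  0 < n ∧ w.IsClosed ∧ w.IsNonBacktracking ∧
    ∀ i j : Fin n, (i : ℕ) = 0 → (j : ℕ) + 1 = n → w.edge i ≠ G.rev (w.edge j)

variable (G)

/-- The number `f_r(G)` of closed non-backtracking walks of length `r`. -/
noncomputable def numClosedNBW (r : ℕ) : ℕ :=
  Nat.card {w : G.Walk r // w.IsClosed ∧ w.IsNonBacktracking}

/-- The number `c_r(G)` of circuits of length `r`. -/
noncomputable def numCircuits (r : ℕ) : ℕ := Nat.card {w : G.Walk r // w.IsCircuit}

/-- The adjacency matrix: the `(a, b)` entry is the number of directed edges from `a` to `b`. -/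
noncomputable def adjMatrix : Matrix V V ℝ :=
  Matrix.of fun a b => (Nat.card {d : D // G.org d = a ∧ G.ter d = b} : ℝ)

theorem adjMatrix_isHermitian : G.adjMatrix.IsHermitian := by
  ext a b
  simp only [adjMatrix, Matrix.conjTranspose_apply, Matrix.of_apply, star_trivial, Nat.cast_inj]
  refine Nat.card_congr ⟨fun d => ⟨G.rev d.1, ?_⟩, fun d => ⟨G.rev d.1, ?_⟩, ?_, ?_⟩
  · exact ⟨d.2.2, by simpa [ter, G.rev_rev] using d.2.1⟩
  · exact ⟨d.2.2, by simpa [ter, G.rev_rev] using d.2.1⟩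
  · intro d; simp [G.rev_rev]
  · intro d; simp [G.rev_rev]

/-- The measure `|V|⁻¹ ∑ₖ δ_{q^{-1/2} λₖ}`, where the `λₖ` are the eigenvalues of the adjacency
matrix listed with multiplicity. -/
noncomputable def spectralMeasure [Fintype V] [DecidableEq V] (q : ℕ) : Measure ℝ :=
  (Fintype.card V : ℝ≥0∞)⁻¹ •
    ∑ k : V, Measure.dirac ((Real.sqrt q)⁻¹ * G.adjMatrix_isHermitian.eigenvalues k)

instance [Fintype V] [DecidableEq V] [Nonempty V] (q : ℕ) :
    IsProbabilityMeasure (G.spectralMeasure q) := by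
  constructor
  simp only [spectralMeasure, Measure.smul_apply, Measure.finsetSum_apply, measure_univ,
    Finset.sum_const, Finset.card_univ, nsmul_eq_mul, mul_one, smul_eq_mul]
  exact ENNReal.inv_mul_cancel (by simp) (by simp)

/-- The normalized spectral measure of a finite `(q+1)`-regular graph, as an element of `P(ℝ)`. -/
noncomputable def spectralLaw [Fintype V] [DecidableEq V] [Nonempty V] (q : ℕ) :
    ProbabilityMeasure ℝ := ⟨G.spectralMeasure q, inferInstance⟩

end Multigraph

/-- The measure `(2π)⁻¹ √(4 - x²) 1_{|x| ≤ 2} dx`. -/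
noncomputable def semicircleMeasure : Measure ℝ :=
  volume.withDensity fun x =>
    ENNReal.ofReal ((Set.Icc (-2 : ℝ) 2).indicator
      (fun x => 1 / (2 * Real.pi) * Real.sqrt (4 - x ^ 2)) x)

instance : IsProbabilityMeasure semicircleMeasure := by
  constructor
  have hc : Continuous fun x : ℝ => 1 / (2 * Real.pi) * Real.sqrt (4 - x ^ 2) := by fun_prop
  have hi : Integrable ((Set.Icc (-2 : ℝ) 2).indicator
      (fun x => 1 / (2 * Real.pi) * Real.sqrt (4 - x ^ 2))) := by
    rw [integrable_indicator_iff measurableSet_Icc]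
    exact hc.continuousOn.integrableOn_Icc
  rw [semicircleMeasure, withDensity_apply _ MeasurableSet.univ, Measure.restrict_univ,
    ← ofReal_integral_eq_lintegral_ofReal hi]
  · rw [integral_indicator measurableSet_Icc, integral_Icc_eq_integral_Ioc,
      ← intervalIntegral.integral_of_le (by norm_num)]
    have h := intervalIntegral.integral_comp_mul_left (a := -1) (b := 1)
      (fun x : ℝ => 1 / (2 * Real.pi) * Real.sqrt (4 - x ^ 2)) (two_ne_zero (α := ℝ))
    have h2 : ∀ x : ℝ, Real.sqrt (4 - (2 * x) ^ 2) = 2 * Real.sqrt (1 - x ^ 2) := by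
      intro x
      rw [show 4 - (2 * x) ^ 2 = 2 ^ 2 * (1 - x ^ 2) by ring, Real.sqrt_mul (by norm_num),
        Real.sqrt_sq (by norm_num)]
    simp only [h2, intervalIntegral.integral_const_mul, integral_sqrt_one_sub_sq] at h
    have hpi := Real.pi_ne_zero
    rw [show (2 : ℝ) * (-1) = -2 by norm_num, show (2 : ℝ) * 1 = 2 by norm_num] at h
    rw [intervalIntegral.integral_const_mul]
    simp only [smul_eq_mul] at h
    rw [ENNReal.ofReal_eq_one]
    field_simp at h ⊢
    linarith
  · refine Eventually.of_forall fun x => Set.indicator_nonneg (fun y _ => ?_) x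
    positivity

/-- The Wigner semicircle distribution `μ_∞`. -/
noncomputable def semicircleLaw : ProbabilityMeasure ℝ := ⟨semicircleMeasure, inferInstance⟩

/-- `μ ∈ P_p(ℝ)`: the `p`-th absolute moment of `μ` is finite. -/
def InWassersteinSpace (p : ℝ) (μ : ProbabilityMeasure ℝ) : Prop :=
  ∫⁻ x, ENNReal.ofReal (|x| ^ p) ∂(μ : Measure ℝ) < ∞

/-- `γ` is a coupling of `μ` and `ν`: its marginals are `μ` and `ν`. -/
def IsCoupling (γ : Measure (ℝ × ℝ)) (μ ν : ProbabilityMeasure ℝ) : Prop :=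
  γ.map Prod.fst = μ ∧ γ.map Prod.snd = ν

/-- The Wasserstein distance `W_p(μ, ν)` for `1 ≤ p < ∞`, with values in `[0, ∞]`. -/
noncomputable def wassersteinDist (p : ℝ) (μ ν : ProbabilityMeasure ℝ) : ℝ≥0∞ :=
  ⨅ (γ : Measure (ℝ × ℝ)) (_ : IsCoupling γ μ ν),
    (∫⁻ z, ENNReal.ofReal (|z.1 - z.2| ^ p) ∂γ) ^ (1 / p)

/-- `μ_n → μ` in the Wasserstein space `P_p(ℝ)`. -/
def TendstoWasserstein (p : ℝ) (μ : ℕ → ProbabilityMeasure ℝ) (ν : ProbabilityMeasure ℝ) : Prop :=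
  (∀ n, InWassersteinSpace p (μ n)) ∧ InWassersteinSpace p ν ∧
    Tendsto (fun n => wassersteinDist p (μ n) ν) atTop (𝓝 0)

/-- The generalized inverse distribution function `F_μ⁻¹(x) = inf {y | μ((-∞, y]) ≥ x}`
(its values outside the open interval `(0, 1)` are irrelevant). -/
noncomputable def invDistFun (μ : ProbabilityMeasure ℝ) (x : ℝ) : ℝ :=
  sInf {y : ℝ | ENNReal.ofReal x ≤ (μ : Measure ℝ) (Set.Iic y)}

/-- `u_n → u` in `L^p[0, 1]`. -/
def TendstoLpUnitInterval (p : ℝ) (u : ℕ → ℝ → ℝ) (v : ℝ → ℝ) : Prop :=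
  (∀ n, MemLp (u n) (ENNReal.ofReal p) (volume.restrict (Set.Icc 0 1))) ∧
    MemLp v (ENNReal.ofReal p) (volume.restrict (Set.Icc 0 1)) ∧
    Tendsto (fun n => eLpNorm (u n - v) (ENNReal.ofReal p) (volume.restrict (Set.Icc 0 1)))
      atTop (𝓝 0)

set_option linter.unusedSectionVars false

namespace Multigraph

/-! ### Matrices attached to a multigraph -/

section Matrices

variable {V D : Type*} (G : Multigraph V D)

/-! All four conditions are compared with convergence of moments. In a `(q+1)`-regular graph,
prepending an edge to a non-backtracking walk gives a three-term recursion for the walk-counting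
matrices. With `x = q^{-1/2} A` it is solved by `S_r(x) - q⁻¹ S_{r-2}(x)`, where `S` is the rescaled
Chebyshev family `S_{r+2} = X S_{r+1} - S_r`. Taking traces, `q^{-r/2} f_r / |V| = ∫ S_r dμ - q⁻¹ ∫
S_{r-2} dμ` (`numClosedNBW_eq_integral`). For `r ≥ 1` the semicircle law annihilates `S_r`, so once
`q → ∞`, (iv) says that the integrals of `S_1, …, S_m` converge to the right limits; by
triangularity the same holds for the moments up to `m`. Conversely `f_2 ≥ 0` gives `q⁻¹ ≤ ∫ S_2 dμ`,
which forces `q → ∞`.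

Deleting a tail relates `f_r` to `c_r` (`numClosedNBW_sub_numCircuits`); after normalization the
relation transfers convergence to zero in both directions, giving (iii) ↔ (iv).

On the analytic side, weak convergence to an atomless law gives almost everywhere convergence of
quantile functions. Since `m` is even, convergence of the `m`-th moment supplies convergent
dominating integrals, and generalized dominated convergence yields both convergence of quantiles in
`L^m` and convergence of lower moments. Quantiles form a coupling, so (ii) implies (i); Minkowski's
inequality recovers the `m`-th moment from `W_m`. -/

theorem rev_injective : Function.Injective G.rev := fun a b h => by
  rw [← G.rev_rev a, h, G.rev_rev]

theorem ter_rev (d : D) : G.ter (G.rev d) = G.org d := by simp [ter, G.rev_rev]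

variable [DecidableEq V] [DecidableEq D]

/-- Incidence matrix between vertices and the directed edges with origin there. -/
def orgMatrix : Matrix V D ℝ := Matrix.of fun v d => if G.org d = v then 1 else 0

/-- Permutation matrix of edge reversal. -/
def revMatrix : Matrix D D ℝ := Matrix.of fun d e => if d = G.rev e then 1 else 0

/-- The relation "`e` may follow `d` in a non-backtracking walk". -/
def Follows (d e : D) : Prop := G.ter d = G.org e ∧ d ≠ G.rev e

instance : DecidableRel G.Follows := fun d e => by unfold Follows; infer_instance

/-- The non-backtracking (Hashimoto) matrix. -/
def nbMatrix : Matrix D D ℝ := Matrix.of fun d e => if G.Follows d e then 1 else 0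

open Matrix

theorem revMatrix_mul_apply [Fintype D] {n : Type*} (M : Matrix D n ℝ) (d : D) (j : n) :
    (G.revMatrix * M) d j = M (G.rev d) j := by
  have h : ∀ e, d = G.rev e ↔ G.rev d = e := fun e =>
    ⟨fun h => by rw [h, G.rev_rev], fun h => by rw [← h, G.rev_rev]⟩
  simp [Matrix.mul_apply, revMatrix, h]

theorem revMatrix_mul_self [Fintype D] : G.revMatrix * G.revMatrix = 1 := by
  ext d e
  rw [revMatrix_mul_apply]
  simp [revMatrix, Matrix.one_apply, G.rev_injective.eq_iff]

theorem orgMatrix_transpose_mul [Fintype V] (d e : D) :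
    (G.orgMatrixᵀ * G.orgMatrix) d e = if G.org d = G.org e then 1 else 0 := by
  simp [Matrix.mul_apply, orgMatrix, eq_comm]

theorem nbMatrix_add_revMatrix_apply (d e : D) :
    (G.nbMatrix + G.revMatrix) d e = if G.ter d = G.org e then 1 else 0 := by
  simp only [nbMatrix, revMatrix, Follows, Matrix.add_apply, Matrix.of_apply]
  by_cases h : d = G.rev e
  · subst h; simp [ter_rev]
  · simp [h]

/-- Edges `d, e` are composable when `rev d` and `e` share their origin; among composable pairs, the
backtracking ones are exactly those recorded by `revMatrix`. -/
theorem revMatrix_mul_org [Fintype V] [Fintype D] :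
    G.revMatrix * (G.orgMatrixᵀ * G.orgMatrix) = G.nbMatrix + G.revMatrix := by
  ext d e
  rw [revMatrix_mul_apply, orgMatrix_transpose_mul, nbMatrix_add_revMatrix_apply]
  rfl

theorem nbMatrix_eq [Fintype V] [Fintype D] :
    G.nbMatrix = G.revMatrix * (G.orgMatrixᵀ * G.orgMatrix - 1) := by
  rw [mul_sub, revMatrix_mul_org, mul_one, add_sub_cancel_right]

theorem orgMatrix_mul_rev_mul [Fintype D] :
    G.orgMatrix * (G.revMatrix * G.orgMatrixᵀ) = G.adjMatrix := by
  ext a b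
  rw [Matrix.mul_apply, adjMatrix, Matrix.of_apply, Nat.card_eq_fintype_card, Fintype.card_subtype]
  simp only [revMatrix_mul_apply, orgMatrix, Matrix.of_apply, Matrix.transpose_apply, ter]
  simp only [mul_ite, mul_one, mul_zero, ← ite_and, Finset.sum_boole, and_comm]
  congr!

theorem orgMatrix_mul_transpose [Fintype D] {k : ℕ} (hG : G.IsRegular k) :
    G.orgMatrix * G.orgMatrixᵀ = (k : ℝ) • (1 : Matrix V V ℝ) := by
  ext a b
  have h := hG a
  rw [Nat.card_eq_fintype_card, Fintype.card_subtype] at h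
  rw [Matrix.mul_apply]
  simp only [orgMatrix, Matrix.of_apply, Matrix.transpose_apply, Matrix.smul_apply,
    Matrix.one_apply, smul_eq_mul]
  rcases eq_or_ne a b with rfl | hab
  · simp only [mul_ite, mul_one, mul_zero, ← ite_and, and_self, Finset.sum_boole, h, if_true]
  · simp only [hab, if_false, mul_zero]
    refine Finset.sum_eq_zero fun d _ => ?_
    by_cases h1 : G.org d = a
    · simp [h1, hab]
    · simp [h1]

variable [Fintype V] [Fintype D]

theorem transpose_mul_sq {q : ℕ} (hG : G.IsRegular (q + 1)) :
    (G.orgMatrixᵀ * G.orgMatrix) * (G.orgMatrixᵀ * G.orgMatrix)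
      = ((q : ℝ) + 1) • (G.orgMatrixᵀ * G.orgMatrix) := by
  rw [Matrix.mul_assoc, ← Matrix.mul_assoc G.orgMatrix, orgMatrix_mul_transpose G hG]
  simp

/-- Write `B = J (T - 1)` with `J² = 1` and `T² = (q + 1) T`. Then `B J B = J (T - 1)²` and `(T -
1)² = (q - 1)(T - 1) + q`. Under a trace this removes a tail from a closed walk. -/
theorem nbMatrix_mul_rev_mul_nbMatrix {q : ℕ} (hG : G.IsRegular (q + 1)) :
    G.nbMatrix * G.revMatrix * G.nbMatrix
      = ((q : ℝ) - 1) • G.nbMatrix + (q : ℝ) • G.revMatrix := by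
  have h1 := G.transpose_mul_sq hG
  have h2 := G.revMatrix_mul_self
  have h3 : G.nbMatrix * G.revMatrix * G.nbMatrix = G.revMatrix *
      ((G.orgMatrixᵀ * G.orgMatrix) * (G.orgMatrixᵀ * G.orgMatrix)
        - 2 • (G.orgMatrixᵀ * G.orgMatrix) + 1) := by
    rw [nbMatrix_eq]
    calc _ = G.revMatrix * (G.orgMatrixᵀ * G.orgMatrix - 1) * (G.revMatrix * G.revMatrix)
          * (G.orgMatrixᵀ * G.orgMatrix - 1) := by simp only [mul_assoc]
      _ = _ := by rw [h2]; noncomm_ring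
  rw [h3, h1, mul_add, mul_sub, mul_smul_comm, mul_smul_comm, revMatrix_mul_org,
    mul_one]
  module

/-- An edge `e` may follow `q` edges: the `q + 1` ending at its origin, except its own inverse. -/
theorem orgMatrix_mul_rev_mul_nbMatrix {q : ℕ} (hG : G.IsRegular (q + 1)) :
    G.orgMatrix * G.revMatrix * G.nbMatrix = (q : ℝ) • G.orgMatrix := by
  rw [nbMatrix_eq, ← Matrix.mul_assoc, Matrix.mul_assoc G.orgMatrix, revMatrix_mul_self,
    Matrix.mul_one, Matrix.mul_sub, ← Matrix.mul_assoc, orgMatrix_mul_transpose G hG,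
    Matrix.smul_mul, Matrix.one_mul, Matrix.mul_one, Nat.cast_add_one, add_smul, one_smul,
    add_sub_cancel_right]

/-- The matrix whose entries count the non-backtracking walks of length `k + 1`. -/
def nbWalkMatrix (k : ℕ) : Matrix V V ℝ :=
  G.orgMatrix * G.nbMatrix ^ k * (G.revMatrix * G.orgMatrixᵀ)

theorem nbWalkMatrix_zero : G.nbWalkMatrix 0 = G.adjMatrix := by
  simp [nbWalkMatrix, orgMatrix_mul_rev_mul]

/-- An edge prepended to a non-backtracking walk either extends it or is the inverse of its first
edge; the last term counts the second case. -/
theorem adjMatrix_mul_nbWalkMatrix (k : ℕ) :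
    G.adjMatrix * G.nbWalkMatrix k = G.nbWalkMatrix (k + 1)
      + G.orgMatrix * G.revMatrix * G.nbMatrix ^ k * (G.revMatrix * G.orgMatrixᵀ) := by
  calc G.adjMatrix * G.nbWalkMatrix k
      = G.orgMatrix * (G.revMatrix * (G.orgMatrixᵀ * G.orgMatrix)) * G.nbMatrix ^ k
          * (G.revMatrix * G.orgMatrixᵀ) := by
        rw [← orgMatrix_mul_rev_mul, nbWalkMatrix]; simp only [Matrix.mul_assoc]
    _ = _ := by
        rw [revMatrix_mul_org, nbWalkMatrix, pow_succ']
        simp only [Matrix.mul_add, Matrix.add_mul, Matrix.mul_assoc]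

theorem adjMatrix_mul_nbWalkMatrix_zero {q : ℕ} (hG : G.IsRegular (q + 1)) :
    G.adjMatrix * G.nbWalkMatrix 0 = G.nbWalkMatrix 1 + ((q : ℝ) + 1) • 1 := by
  rw [adjMatrix_mul_nbWalkMatrix, pow_zero, Matrix.mul_one, Matrix.mul_assoc,
    ← Matrix.mul_assoc G.revMatrix, revMatrix_mul_self, Matrix.one_mul,
    orgMatrix_mul_transpose G hG]
  simp

/-- Cancelling the backtracking pair leaves a shorter walk, which arises `q` times. For walks of
length one nothing remains to restrict the cancelled edge, hence the `q + 1` in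
`adjMatrix_mul_nbWalkMatrix_zero`. -/
theorem adjMatrix_mul_nbWalkMatrix_succ {q : ℕ} (hG : G.IsRegular (q + 1)) (k : ℕ) :
    G.adjMatrix * G.nbWalkMatrix (k + 1)
      = G.nbWalkMatrix (k + 2) + (q : ℝ) • G.nbWalkMatrix k := by
  rw [adjMatrix_mul_nbWalkMatrix, pow_succ' G.nbMatrix k, ← Matrix.mul_assoc _ G.nbMatrix,
    orgMatrix_mul_rev_mul_nbMatrix G hG]
  simp [nbWalkMatrix, Matrix.mul_assoc]

open Polynomial in
/-- Non-backtracking walk matrices are Chebyshev-type polynomials in the adjacency matrix. -/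
theorem nbWalkMatrix_eq_aeval {q : ℕ} (hq : 1 ≤ q) (hG : G.IsRegular (q + 1)) (k : ℕ) :
    G.nbWalkMatrix k = (Real.sqrt q) ^ (k + 1) •
      aeval ((Real.sqrt q)⁻¹ • G.adjMatrix)
        (Chebyshev.S ℝ ((k : ℤ) + 1) - Polynomial.C (q : ℝ)⁻¹ * Chebyshev.S ℝ ((k : ℤ) - 1)) := by
  have hq' : (0 : ℝ) < q := by exact_mod_cast hq
  set s := Real.sqrt q with hs
  have hs0 : s ≠ 0 := (Real.sqrt_pos.2 hq').ne'
  have hsq : (q : ℝ) = s ^ 2 := (Real.sq_sqrt hq'.le).symm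
  set x := s⁻¹ • G.adjMatrix with hx
  have hA : G.adjMatrix = s • x := by rw [hx, smul_smul, mul_inv_cancel₀ hs0, one_smul]
  induction k using Nat.twoStepInduction with
  | zero =>
    simp [nbWalkMatrix_zero, hA]
  | one =>
    -- The exceptional coefficient `q + 1` matches the constant term of `S_2 - q⁻¹ S_0 = X² - 1 -
    -- q⁻¹`.
    have h := G.adjMatrix_mul_nbWalkMatrix_zero hG
    rw [nbWalkMatrix_zero] at h
    rw [eq_sub_of_add_eq h.symm, hA, hsq]
    have : ((1 : ℕ) : ℤ) + 1 = 2 := rfl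
    rw [this]
    simp only [Nat.cast_one, sub_self, Chebyshev.S_two, Chebyshev.S_zero, map_sub, map_mul,
      aeval_X, map_one, aeval_C, Algebra.algebraMap_eq_smul_one, mul_one, smul_mul_smul_comm, pow_two]
    rw [smul_sub, smul_sub, smul_smul]
    match_scalars <;> field_simp; ring
  | more k ih1 ih2 =>
    have h := G.adjMatrix_mul_nbWalkMatrix_succ hG k
    rw [eq_sub_of_add_eq h.symm, ih1, ih2, hA]
    have e1 : ((k + 2 : ℕ) : ℤ) + 1 = ((k : ℤ) + 1) + 2 := by push_cast; ring
    have e2 : ((k + 2 : ℕ) : ℤ) - 1 = ((k : ℤ) - 1) + 2 := by push_cast; ring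
    have e3 : ((k + 1 : ℕ) : ℤ) + 1 = ((k : ℤ) + 1) + 1 := by push_cast; ring
    have e4 : ((k + 1 : ℕ) : ℤ) - 1 = ((k : ℤ) - 1) + 1 := by push_cast; ring
    rw [e1, e2, e3, e4, Chebyshev.S_add_two, Chebyshev.S_add_two ℝ ((k : ℤ) - 1)]
    simp only [map_sub, map_mul, aeval_X, aeval_C, Algebra.algebraMap_eq_smul_one, mul_sub,
      smul_mul_assoc, one_mul, mul_smul_comm, smul_sub, smul_smul]
    rw [hsq]
    match_scalars <;> field_simp <;> ring

open Polynomial in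
theorem _root_.Matrix.IsHermitian.trace_aeval_smul {A : Matrix V V ℝ} (hA : A.IsHermitian) (c : ℝ)
    (P : ℝ[X]) : (aeval (c • A) P).trace = ∑ k, P.eval (c * hA.eigenvalues k) := by
  have h := hA.spectral_theorem
  set φ := Unitary.conjStarAlgAut ℝ (Matrix V V ℝ) hA.eigenvectorUnitary with hφ
  have h1 : c • A = (φ : Matrix V V ℝ →ₐ[ℝ] Matrix V V ℝ)
      (Matrix.diagonalAlgHom ℝ (fun k => c * hA.eigenvalues k)) := by
    conv_lhs => rw [h]
    have : (Matrix.diagonalAlgHom ℝ (fun k => c * hA.eigenvalues k) : Matrix V V ℝ)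
      = c • diagonal (RCLike.ofReal ∘ hA.eigenvalues) := by
      ext i j; simp [Matrix.diagonal_apply]
    rw [this]; simp
  rw [h1, aeval_algHom_apply, aeval_algHom_apply]
  have h2 : aeval (fun k => c * hA.eigenvalues k) P
      = fun k => P.eval (c * hA.eigenvalues k) := by
    ext k; simp [aeval_fn_apply]
  have h3 (M : Matrix V V ℝ) : (φ : Matrix V V ℝ →ₐ[ℝ] Matrix V V ℝ) M = φ M := rfl
  rw [h2, h3, Unitary.conjStarAlgAut_apply, Matrix.trace_mul_cycle,
    Unitary.coe_star_mul_self, one_mul]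
  exact Matrix.trace_diagonal _

end Matrices
end Multigraph

namespace Multigraph

/-! ### Counting walks by traces -/

section Counting

open Matrix

/-- The arbitrary endpoint weight `g` lets the induction absorb the first step of the path, and
later encodes how a walk closes up. -/
theorem _root_.Matrix.sum_prod_path_mul {D : Type*} [Fintype D] [DecidableEq D] (B : Matrix D D ℝ)
    (r : ℕ) (g : D → D → ℝ) :
    ∑ e : Fin (r + 1) → D, (∏ i : Fin r, B (e i.castSucc) (e i.succ)) * g (e 0) (e (Fin.last r))
      = ∑ a, ∑ b, (B ^ r) a b * g a b := by
  induction r generalizing g with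
  | zero =>
    rw [← (Equiv.funUnique (Fin 1) D).symm.sum_comp]
    simp [Matrix.one_apply]
  | succ r ih =>
    rw [← (Fin.consEquiv (fun _ => D)).sum_comp, Fintype.sum_prod_type]
    refine Finset.sum_congr rfl fun a _ => ?_
    have h := ih (fun x y => B a x * g a y)
    calc _ = ∑ e : Fin (r + 1) → D, (∏ i : Fin r, B (e i.castSucc) (e i.succ))
          * (B a (e 0) * g a (e (Fin.last r))) := by
          refine Finset.sum_congr rfl fun e _ => ?_
          rw [Fin.prod_univ_succ]
          simp only [Fin.consEquiv_apply, Fin.cons_zero, Fin.cons_succ, Fin.castSucc_zero,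
            ← Fin.succ_last, ← Fin.succ_castSucc]
          ring
      _ = _ := by
          rw [h, Finset.sum_comm]
          refine Finset.sum_congr rfl fun b _ => ?_
          rw [pow_succ', Matrix.mul_apply, Finset.sum_mul]
          exact Finset.sum_congr rfl fun x _ => by ring

variable {V D : Type*} (G : Multigraph V D)

/-- A walk of positive length is determined by its directed edges. -/
def walkEquiv (r : ℕ) : G.Walk (r + 1) ≃
    {e : Fin (r + 1) → D // ∀ i : Fin r, G.ter (e i.castSucc) = G.org (e i.succ)} where
  toFun w := ⟨w.edge, fun i => by
    rw [← w.ter_edge, ← w.org_edge, Fin.succ_castSucc]⟩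
  invFun e :=
    { vert := Fin.cons (G.org (e.1 0)) fun i => G.ter (e.1 i)
      edge := e.1
      org_edge := fun i => by
        induction i using Fin.cases with
        | zero => simp
        | succ i => rw [← Fin.succ_castSucc, Fin.cons_succ, e.2]
      ter_edge := fun i => by rw [Fin.cons_succ] }
  left_inv w := by
    obtain ⟨v, e, h1, h2⟩ := w
    simp only [Walk.mk.injEq, and_true]
    funext i
    induction i using Fin.cases with
    | zero => rw [Fin.cons_zero, ← h1]; rfl
    | succ i => rw [Fin.cons_succ, h2]
  right_inv e := rfl

variable [DecidableEq V] [DecidableEq D] [Fintype D]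

/-- `R` is the condition between the last and first edges: `Follows` for circuits, mere
composability for closed walks. -/
theorem card_walk_eq_trace (r : ℕ) (R : D → D → Prop) [DecidableRel R]
    (P : G.Walk (r + 1) → Prop)
    (hP : ∀ w, P w ↔ (∀ i : Fin r, G.Follows (w.edge i.castSucc) (w.edge i.succ)) ∧
      R (w.edge (Fin.last r)) (w.edge 0)) :
    (Nat.card {w // P w} : ℝ)
      = (G.nbMatrix ^ r * Matrix.of fun d e => if R d e then (1 : ℝ) else 0).trace := by
  have e1 : {w // P w} ≃ {e : Fin (r + 1) → D //
      (∀ i : Fin r, G.Follows (e i.castSucc) (e i.succ)) ∧ R (e (Fin.last r)) (e 0)} :=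
    ((G.walkEquiv r).subtypeEquiv (p := P) (q := fun e =>
      (∀ i : Fin r, G.Follows (e.1 i.castSucc) (e.1 i.succ)) ∧ R (e.1 (Fin.last r)) (e.1 0))
      hP).trans (Equiv.subtypeSubtypeEquivSubtype (q := fun e : Fin (r + 1) → D =>
        (∀ i : Fin r, G.Follows (e i.castSucc) (e i.succ)) ∧ R (e (Fin.last r)) (e 0))
        fun h i => (h.1 i).1)
  rw [Nat.card_congr e1, Nat.card_eq_fintype_card, Fintype.card_subtype]
  have h := Matrix.sum_prod_path_mul G.nbMatrix r (fun a b => if R b a then (1 : ℝ) else 0)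
  simp only [Matrix.trace, Matrix.diag_apply, Matrix.mul_apply, Matrix.of_apply]
  rw [← h]
  simp only [nbMatrix, Matrix.of_apply, Finset.prod_boole, Finset.mem_univ, true_imp_iff,
    mul_ite, mul_one, mul_zero, ← ite_and, Finset.sum_boole, and_comm]

theorem Walk.isNonBacktracking_iff {G : Multigraph V D} {r : ℕ} (w : G.Walk (r + 1)) :
    w.IsNonBacktracking ↔ ∀ i : Fin r, G.Follows (w.edge i.castSucc) (w.edge i.succ) := by
  constructor
  · exact fun h i => ⟨((G.walkEquiv r) w).2 i, h _ _ (by simp)⟩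
  · intro h i j hij
    have hi : (i : ℕ) < r := by omega
    have h1 := (h ⟨i, hi⟩).2
    have h2 : (⟨i, hi⟩ : Fin r).succ = j := Fin.ext (by simp [hij])
    rwa [h2] at h1

theorem Walk.isClosed_iff {G : Multigraph V D} {r : ℕ} (w : G.Walk (r + 1)) :
    w.IsClosed ↔ G.ter (w.edge (Fin.last r)) = G.org (w.edge 0) := by
  rw [← w.org_edge, ← w.ter_edge, Fin.succ_last, Fin.castSucc_zero, Walk.IsClosed, eq_comm]

theorem Walk.isCircuit_iff {G : Multigraph V D} {r : ℕ} (w : G.Walk (r + 1)) :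
    w.IsCircuit ↔ (∀ i : Fin r, G.Follows (w.edge i.castSucc) (w.edge i.succ)) ∧
      G.Follows (w.edge (Fin.last r)) (w.edge 0) := by
  have h : (∀ i j : Fin (r + 1), (i : ℕ) = 0 → (j : ℕ) + 1 = r + 1 → w.edge i ≠ G.rev (w.edge j))
      ↔ w.edge (Fin.last r) ≠ G.rev (w.edge 0) := by
    have h1 : w.edge (Fin.last r) ≠ G.rev (w.edge 0) ↔ w.edge 0 ≠ G.rev (w.edge (Fin.last r)) := by
      rw [not_iff_not]
      exact ⟨fun h => by rw [h, G.rev_rev], fun h => by rw [h, G.rev_rev]⟩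
    rw [h1]
    refine ⟨fun h => h 0 (Fin.last r) rfl rfl, fun h i j hi hj => ?_⟩
    obtain rfl : i = 0 := Fin.ext hi
    obtain rfl : j = Fin.last r := Fin.ext (by simpa using hj)
    exact h
  rw [Walk.IsCircuit, h, isClosed_iff, isNonBacktracking_iff, Follows]
  simp
  tauto

theorem numCircuits_eq_trace (r : ℕ) :
    (G.numCircuits (r + 1) : ℝ) = (G.nbMatrix ^ r * G.nbMatrix).trace :=
  G.card_walk_eq_trace r G.Follows _ fun w => w.isCircuit_iff

theorem numClosedNBW_eq_trace (r : ℕ) :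
    (G.numClosedNBW (r + 1) : ℝ) = (G.nbMatrix ^ r * (G.nbMatrix + G.revMatrix)).trace := by
  have h : G.nbMatrix + G.revMatrix
      = Matrix.of fun d e => if G.ter d = G.org e then (1 : ℝ) else 0 := by
    ext d e; rw [nbMatrix_add_revMatrix_apply]; rfl
  rw [h]
  exact G.card_walk_eq_trace r (fun d e => G.ter d = G.org e) _ fun w => by
    rw [w.isClosed_iff, w.isNonBacktracking_iff, and_comm]

variable [Fintype V]

/-- Closed non-backtracking walks that are not circuits are obtained by adding a tail. -/
theorem numClosedNBW_sub_numCircuits {q : ℕ} (hG : G.IsRegular (q + 1)) (r : ℕ) :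
    (G.numClosedNBW (r + 3) : ℝ) - G.numCircuits (r + 3)
      = q * G.numClosedNBW (r + 1) - G.numCircuits (r + 1) := by
  -- The difference of the two counts is this trace; cyclicity moves one factor to the other side of
  -- `revMatrix`.
  have h1 : (G.nbMatrix ^ (r + 2) * G.revMatrix).trace
      = (G.nbMatrix ^ r * (G.nbMatrix * G.revMatrix * G.nbMatrix)).trace := by
    rw [pow_succ', Matrix.mul_assoc, Matrix.trace_mul_comm, pow_succ]
    simp only [Matrix.mul_assoc]
  rw [numClosedNBW_eq_trace, numCircuits_eq_trace, numClosedNBW_eq_trace, numCircuits_eq_trace,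
    Matrix.mul_add, Matrix.mul_add, Matrix.trace_add, Matrix.trace_add, add_sub_cancel_left, h1,
    nbMatrix_mul_rev_mul_nbMatrix G hG, Matrix.mul_add, Matrix.trace_add, Matrix.mul_smul,
    Matrix.mul_smul, Matrix.trace_smul, Matrix.trace_smul, smul_eq_mul, smul_eq_mul]
  ring

/-- No edge is its own inverse, so `revMatrix` has zero diagonal. -/
theorem numClosedNBW_one : G.numClosedNBW 1 = G.numCircuits 1 := by
  have h : (G.numClosedNBW 1 : ℝ) = G.numCircuits 1 := by
    rw [numClosedNBW_eq_trace, numCircuits_eq_trace]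
    have : G.revMatrix.trace = 0 := by
      simp [Matrix.trace, revMatrix, (G.rev_ne _).symm]
    simp [this, Matrix.trace_add]
  exact_mod_cast h

/-- At length two the cyclic condition is the non-backtracking condition read backwards. Lengths one
and two start the recursion, which advances by two. -/
theorem numClosedNBW_two : G.numClosedNBW 2 = G.numCircuits 2 := by
  have h : (G.numClosedNBW 2 : ℝ) = G.numCircuits 2 := by
    rw [numClosedNBW_eq_trace, numCircuits_eq_trace]
    have : (G.revMatrix * G.nbMatrix).trace = 0 := by
      simp only [Matrix.trace, Matrix.diag_apply, revMatrix_mul_apply]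
      refine Finset.sum_eq_zero fun d _ => ?_
      simp [nbMatrix, Follows]
    rw [pow_one, Matrix.mul_add, Matrix.trace_add, Matrix.trace_mul_comm _ G.revMatrix, this,
      add_zero]
  exact_mod_cast h

theorem numClosedNBW_eq_trace_nbWalkMatrix (r : ℕ) :
    (G.numClosedNBW (r + 1) : ℝ) = (G.nbWalkMatrix r).trace := by
  rw [numClosedNBW_eq_trace, ← revMatrix_mul_org, nbWalkMatrix, Matrix.mul_assoc,
    Matrix.trace_mul_comm G.orgMatrix]
  simp only [Matrix.mul_assoc]

open Polynomial

theorem integral_spectralMeasure (q : ℕ) (f : ℝ → ℝ) :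
    ∫ x, f x ∂(G.spectralMeasure q) = (Fintype.card V : ℝ)⁻¹ *
      ∑ k, f ((Real.sqrt q)⁻¹ * G.adjMatrix_isHermitian.eigenvalues k) := by
  rw [spectralMeasure, integral_smul_measure, integral_finsetSum_measure]
  · simp
  · intro k _
    exact integrable_dirac (by simp)

/-- Normalized numbers of closed non-backtracking walks as integrals of Chebyshev polynomials. -/
theorem numClosedNBW_eq_integral {q : ℕ} (hq : 1 ≤ q) (hG : G.IsRegular (q + 1)) (r : ℕ) :
    (q : ℝ) ^ (-(((r + 1 : ℕ) : ℝ) / 2)) * ((G.numClosedNBW (r + 1) : ℝ) / (Fintype.card V : ℝ))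
      = ∫ x, (Chebyshev.S ℝ ((r : ℤ) + 1)).eval x ∂(G.spectralMeasure q)
        - (q : ℝ)⁻¹ * ∫ x, (Chebyshev.S ℝ ((r : ℤ) - 1)).eval x ∂(G.spectralMeasure q) := by
  have hq' : (0 : ℝ) < q := by exact_mod_cast hq
  have hpow : (q : ℝ) ^ (-(((r + 1 : ℕ) : ℝ) / 2)) = ((Real.sqrt q) ^ (r + 1))⁻¹ := by
    rw [Real.rpow_neg hq'.le, Real.sqrt_eq_rpow, ← Real.rpow_natCast, ← Real.rpow_mul hq'.le]
    congr 2; ring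
  rw [numClosedNBW_eq_trace_nbWalkMatrix, G.nbWalkMatrix_eq_aeval hq hG, Matrix.trace_smul,
    G.adjMatrix_isHermitian.trace_aeval_smul, hpow, integral_spectralMeasure,
    integral_spectralMeasure]
  simp only [eval_sub, eval_mul, eval_C, Finset.sum_sub_distrib, ← Finset.mul_sum, smul_eq_mul]
  have : Real.sqrt q ^ (r + 1) ≠ 0 := by positivity
  field_simp

end Counting
end Multigraph

/-! ### The semicircle law -/

section Semicircle

theorem integral_semicircleMeasure (f : ℝ → ℝ) :
    ∫ x, f x ∂semicircleMeasure
      = ∫ x in (-2)..2, 1 / (2 * Real.pi) * Real.sqrt (4 - x ^ 2) * f x := by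
  rw [semicircleMeasure, integral_withDensity_eq_integral_toReal_smul]
  · rw [intervalIntegral.integral_of_le (by norm_num), ← integral_Icc_eq_integral_Ioc,
      ← integral_indicator measurableSet_Icc]
    refine integral_congr_ae (Eventually.of_forall fun x => ?_)
    by_cases hx : x ∈ Set.Icc (-2 : ℝ) 2
    · simp only [Set.indicator_of_mem hx, smul_eq_mul]
      rw [ENNReal.toReal_ofReal (by positivity)]
    · simp [Set.indicator_of_notMem hx]
  · refine ENNReal.measurable_ofReal.comp (Measurable.indicator ?_ measurableSet_Icc)
    fun_prop
  · simp

theorem integral_cos_nat_mul {n : ℕ} (hn : n ≠ 0) :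
    ∫ x in (0 : ℝ)..Real.pi, Real.cos (n * x) = 0 := by
  have hn' : (n : ℝ) ≠ 0 := by exact_mod_cast hn
  rw [intervalIntegral.integral_comp_mul_left (fun x => Real.cos x) hn', integral_cos]
  simp [Real.sin_nat_mul_pi]

open Polynomial in
-- Under `x = 2 cos θ` the integrand becomes `(2/π) sin θ sin((n+2)θ)`, a difference of cosines of
-- nonzero integer frequencies, each with integral zero over `[0, π]`.
theorem integral_chebyshevS_semicircleMeasure (n : ℕ) :
    ∫ x, (Chebyshev.S ℝ ((n : ℤ) + 1)).eval x ∂semicircleMeasure = 0 := by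
  rw [integral_semicircleMeasure]
  set g : ℝ → ℝ := fun x => 1 / (2 * Real.pi) * Real.sqrt (4 - x ^ 2) *
    (Chebyshev.S ℝ ((n : ℤ) + 1)).eval x with hg
  have hgc : Continuous g := by fun_prop
  have h := intervalIntegral.integral_comp_mul_deriv (a := 0) (b := Real.pi)
    (f := fun x => 2 * Real.cos x) (f' := fun x => 2 * -Real.sin x) (g := g)
    (fun x _ => (Real.hasDerivAt_cos x).const_mul 2) (by fun_prop) hgc
  simp only [Real.cos_zero, Real.cos_pi, mul_one, mul_neg] at h
  -- The substitution reverses orientation, which cancels the sign of the derivative of cosine.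
  rw [intervalIntegral.integral_symm (-2) 2, intervalIntegral.integral_neg, neg_inj] at h
  rw [← h]
  have h2 : ∫ x in (0 : ℝ)..Real.pi, (g ∘ fun x => 2 * Real.cos x) x * (2 * Real.sin x)
      = ∫ x in (0 : ℝ)..Real.pi, 1 / Real.pi *
        (Real.cos ((n + 1 : ℕ) * x) - Real.cos ((n + 3 : ℕ) * x)) := by
    refine intervalIntegral.integral_congr fun x hx => ?_
    rw [Set.uIcc_of_le Real.pi_pos.le] at hx
    have hsin : 0 ≤ Real.sin x := Real.sin_nonneg_of_mem_Icc hx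
    have hsq : Real.sqrt (4 - (2 * Real.cos x) ^ 2) = 2 * Real.sin x := by
      rw [show 4 - (2 * Real.cos x) ^ 2 = (2 * Real.sin x) ^ 2 by
        nlinarith [Real.sin_sq_add_cos_sq x], Real.sqrt_sq (by positivity)]
    have hS := Chebyshev.S_two_mul_real_cos x ((n : ℤ) + 1)
    have h1 : ((n + 1 : ℕ) : ℝ) * x = ((n : ℝ) + 2) * x - x := by push_cast; ring
    have h3 : ((n + 3 : ℕ) : ℝ) * x = ((n : ℝ) + 2) * x + x := by push_cast; ring
    have h4 : ((((n : ℤ) + 1 : ℤ) : ℝ) + 1) * x = ((n : ℝ) + 2) * x := by push_cast; ring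
    rw [h4] at hS
    simp only [hg, Function.comp, hsq, h1, h3, Real.cos_sub, Real.cos_add]
    have hpi := Real.pi_ne_zero
    field_simp
    linear_combination 2 * Real.sin x * hS
  rw [h2, intervalIntegral.integral_const_mul, intervalIntegral.integral_sub,
    integral_cos_nat_mul (by omega), integral_cos_nat_mul (by omega)]
  · simp
  · exact (by fun_prop : Continuous _).intervalIntegrable _ _
  · exact (by fun_prop : Continuous _).intervalIntegrable _ _

instance : NullSingletonClass semicircleMeasure := by
  unfold semicircleMeasure; infer_instance

theorem ae_abs_le_semicircleMeasure : ∀ᵐ x ∂semicircleMeasure, |x| ≤ 2 := by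
  rw [semicircleMeasure, ae_withDensity_iff]
  · refine Eventually.of_forall fun x hx => ?_
    by_contra h
    rw [abs_le] at h
    exact hx (by rw [Set.indicator_of_notMem (by exact h), ENNReal.ofReal_zero])
  · refine ENNReal.measurable_ofReal.comp (Measurable.indicator ?_ measurableSet_Icc)
    fun_prop

end Semicircle

/-! ### Quantile functions -/

section Quantile

open ProbabilityTheory

variable (μ : ProbabilityMeasure ℝ)

/-- Right-continuity of the distribution function makes the infimum attained; for `x` in the open
interval the set is nonempty and bounded below. -/
theorem invDistFun_le_iff {x : ℝ} (hx : x ∈ Set.Ioo (0 : ℝ) 1) (y : ℝ) :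
    invDistFun μ x ≤ y ↔ x ≤ cdf (μ : Measure ℝ) y := by
  set F := cdf (μ : Measure ℝ) with hF
  have hset : {y : ℝ | ENNReal.ofReal x ≤ (μ : Measure ℝ) (Set.Iic y)} = {y | x ≤ F y} := by
    ext y
    rw [Set.mem_ofPred_eq, ← ofReal_cdf, ENNReal.ofReal_le_ofReal_iff (cdf_nonneg _ _)]
    rfl
  have hne : {y | x ≤ F y}.Nonempty :=
    ((tendsto_cdf_atTop (μ : Measure ℝ)).eventually_const_le hx.2).exists
  obtain ⟨b, hb⟩ := ((tendsto_cdf_atBot (μ : Measure ℝ)).eventually_lt_const hx.1).exists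
  have hbdd : BddBelow {y | x ≤ F y} := by
    refine ⟨b, fun y hy => ?_⟩
    by_contra hlt
    have := monotone_cdf (μ : Measure ℝ) (not_le.1 hlt).le
    exact absurd (hy.trans this) (not_le.2 hb)
  rw [invDistFun, hset]
  refine ⟨fun h => ?_, fun h => csInf_le hbdd h⟩
  have hr : Tendsto F (𝓝[>] y) (𝓝 (F y)) :=
    ((F.right_continuous y).mono Set.Ioi_subset_Ici_self).tendsto
  refine ge_of_tendsto hr ?_
  filter_upwards [self_mem_nhdsWithin] with z hz
  obtain ⟨w, hw, hwz⟩ := exists_lt_of_csInf_lt hne (h.trans_lt hz)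
  exact le_trans hw (monotone_cdf _ hwz.le)

theorem monotoneOn_invDistFun : MonotoneOn (invDistFun μ) (Set.Ioo 0 1) := fun _ hx _ hy hxy =>
  (invDistFun_le_iff μ hx _).2 (hxy.trans ((invDistFun_le_iff μ hy _).1 le_rfl))

theorem restrict_Icc_eq_Ioo :
    (volume : Measure ℝ).restrict (Set.Icc 0 1) = volume.restrict (Set.Ioo 0 1) :=
  (Measure.restrict_congr_set Ioo_ae_eq_Icc).symm

instance : IsProbabilityMeasure ((volume : Measure ℝ).restrict (Set.Icc 0 1)) := ⟨by simp⟩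

theorem aemeasurable_invDistFun : AEMeasurable (invDistFun μ) (volume.restrict (Set.Icc 0 1)) := by
  rw [restrict_Icc_eq_Ioo]
  exact aemeasurable_restrict_of_monotoneOn measurableSet_Ioo (monotoneOn_invDistFun μ)

/-- By the Galois connection the preimage of `(-∞, y]` is, up to a null set, `(0, F(y)]`, of length
`F(y)`. -/
theorem map_invDistFun : (volume.restrict (Set.Icc 0 1)).map (invDistFun μ) = (μ : Measure ℝ) := by
  have := Measure.isProbabilityMeasure_map (aemeasurable_invDistFun μ)
  refine Measure.ext_of_Iic _ _ fun y => ?_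
  rw [Measure.map_apply_of_aemeasurable (aemeasurable_invDistFun μ) measurableSet_Iic,
    restrict_Icc_eq_Ioo, Measure.restrict_apply' measurableSet_Ioo]
  have h : invDistFun μ ⁻¹' Set.Iic y ∩ Set.Ioo 0 1
      = Set.Iic (cdf (μ : Measure ℝ) y) ∩ Set.Ioo 0 1 := by
    ext x
    simp only [Set.mem_inter_iff, Set.mem_preimage, Set.mem_Iic]
    exact and_congr_left fun hx => invDistFun_le_iff μ hx y
  have h2 : (Set.Iic (cdf (μ : Measure ℝ) y) ∩ Set.Ioo 0 1 : Set ℝ)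
      =ᵐ[volume] (Set.Iic (cdf (μ : Measure ℝ) y) ∩ Set.Ioc 0 1 : Set ℝ) :=
    Filter.EventuallyEq.rfl.inter Ioo_ae_eq_Ioc
  rw [h, measure_congr h2, Set.inter_comm, Set.Ioc_inter_Iic, Real.volume_Ioc, sub_zero,
    min_eq_right (cdf_le_one _ _), ofReal_cdf]

theorem tendsto_cdf {μ : ℕ → ProbabilityMeasure ℝ} {ν : ProbabilityMeasure ℝ}
    [NullSingletonClass (ν : Measure ℝ)] (h : Tendsto μ atTop (𝓝 ν)) (y : ℝ) :
    Tendsto (fun n => cdf (μ n : Measure ℝ) y) atTop (𝓝 (cdf (ν : Measure ℝ) y)) := by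
  have h1 := ProbabilityMeasure.tendsto_measure_of_null_frontier_of_tendsto' h
    (E := Set.Iic y) (by simp)
  simp only [cdf_eq_real]
  exact (ENNReal.tendsto_toReal (measure_ne_top _ _)).comp h1

/-- Weak convergence to an atomless limit implies almost everywhere convergence of quantiles. -/
theorem ae_tendsto_invDistFun {μ : ℕ → ProbabilityMeasure ℝ} {ν : ProbabilityMeasure ℝ}
    [NullSingletonClass (ν : Measure ℝ)] (h : Tendsto μ atTop (𝓝 ν)) :
    ∀ᵐ x ∂volume.restrict (Set.Icc (0 : ℝ) 1),
      Tendsto (fun n => invDistFun (μ n) x) atTop (𝓝 (invDistFun ν x)) := by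
  rw [restrict_Icc_eq_Ioo, ae_restrict_iff' measurableSet_Ioo]
  -- A monotone function has only countably many discontinuities; all other points of the interval
  -- work.
  filter_upwards [(monotoneOn_invDistFun ν).countable_not_continuousWithinAt.ae_notMem volume]
    with x hx hx01
  have hc : ContinuousAt (invDistFun ν) x := by
    by_contra hcon
    refine hx ⟨hx01, fun hw => hcon (hw.continuousAt (isOpen_Ioo.mem_nhds hx01))⟩
  refine tendsto_order.2 ⟨fun y hy => ?_, fun y hy => ?_⟩
  · have h1 : cdf (ν : Measure ℝ) y < x := by
      by_contra hle
      exact absurd ((invDistFun_le_iff ν hx01 y).2 (not_lt.1 hle)) (not_le.2 hy)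
    filter_upwards [(tendsto_cdf h y).eventually_lt_const h1] with n hn
    by_contra hle
    exact absurd ((invDistFun_le_iff (μ n) hx01 y).1 (not_lt.1 hle)) (not_le.2 hn)
  -- Continuity at `x` provides `x' > x` whose quantile is still below `z`, so `F(z) ≥ x'` exceeds
  -- `x` strictly and the inequality survives for large `n`.
  · obtain ⟨z, hz1, hz2⟩ := exists_between hy
    have h1 : ∀ᶠ x' in 𝓝[>] x, invDistFun ν x' < z ∧ x' ∈ Set.Ioo (0 : ℝ) 1 :=
      ((hc.tendsto.eventually_lt_const hz1).and (isOpen_Ioo.mem_nhds hx01)).filter_mono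
        nhdsWithin_le_nhds
    obtain ⟨x', ⟨hx'1, hx'2⟩, hx'3⟩ := (h1.and self_mem_nhdsWithin).exists
    have h2 : x < cdf (ν : Measure ℝ) z :=
      lt_of_lt_of_le hx'3 ((invDistFun_le_iff ν hx'2 z).1 hx'1.le)
    filter_upwards [(tendsto_cdf h z).eventually_const_lt h2] with n hn
    exact ((invDistFun_le_iff (μ n) hx01 z).2 hn.le).trans_lt hz2

theorem integral_comp_invDistFun {f : ℝ → ℝ} (hf : Continuous f) :
    ∫ x in Set.Icc (0 : ℝ) 1, f (invDistFun μ x) = ∫ y, f y ∂(μ : Measure ℝ) := by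
  conv_rhs => rw [← map_invDistFun μ]
  rw [integral_map (aemeasurable_invDistFun μ) hf.aestronglyMeasurable]

end Quantile

/-! ### Dominated convergence with varying bounds -/

section Domination

variable {Ω : Type*} [MeasurableSpace Ω] {P : Measure Ω}

/-- Pratt's form of dominated convergence. The difference `|f_n - f₀|` is at most its truncation at
`|g₀| + |f₀|` plus `(g_n - g₀) + (g₀ - g_n)⁺`. The truncation and the positive part have fixed
integrable bounds (the latter because `g_n ≥ 0`), and `∫ (g_n - g₀) → 0` by hypothesis. -/
theorem tendsto_integral_abs_sub_of_tendsto_bound {f g : ℕ → Ω → ℝ} {f₀ g₀ : Ω → ℝ}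
    (hf : ∀ n, AEStronglyMeasurable (f n) P) (hf₀ : Integrable f₀ P)
    (hg : ∀ n, Integrable (g n) P) (hg₀ : Integrable g₀ P) (hfg : ∀ n x, |f n x| ≤ g n x)
    (hflim : ∀ᵐ x ∂P, Tendsto (fun n => f n x) atTop (𝓝 (f₀ x)))
    (hglim : ∀ᵐ x ∂P, Tendsto (fun n => g n x) atTop (𝓝 (g₀ x)))
    (hint : Tendsto (fun n => ∫ x, g n x ∂P) atTop (𝓝 (∫ x, g₀ x ∂P))) :
    Tendsto (fun n => ∫ x, |f n x - f₀ x| ∂P) atTop (𝓝 0) := by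
  have hfi : ∀ n, Integrable (f n) P := fun n =>
    (hg n).mono' (hf n) (Eventually.of_forall fun x => hfg n x)
  have hd : ∀ n, Integrable (fun x => |f n x - f₀ x|) P := fun n => ((hfi n).sub hf₀).abs
  have hG : Integrable (fun x => |g₀ x| + |f₀ x|) P := hg₀.abs.add hf₀.abs
  have hpos : ∀ n, Integrable (fun x => max (g₀ x - g n x) 0) P := fun n =>
    (hg₀.sub (hg n)).pos_part
  have h1 : Tendsto (fun n => ∫ x, min |f n x - f₀ x| (|g₀ x| + |f₀ x|) ∂P) atTop (𝓝 0) := by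
    have := tendsto_integral_of_dominated_convergence (μ := P)
      (F := fun n x => min |f n x - f₀ x| (|g₀ x| + |f₀ x|)) (f := fun _ => (0 : ℝ))
      (fun x => |g₀ x| + |f₀ x|) (fun n => ((hd n).inf hG).aestronglyMeasurable) hG
      (fun n => Eventually.of_forall fun x => ?_) ?_
    · simpa using this
    · rw [Real.norm_of_nonneg (by positivity)]
      exact min_le_right _ _
    · filter_upwards [hflim] with x hx
      have h0 : Tendsto (fun n => |f n x - f₀ x|) atTop (𝓝 0) := by
        simpa using (hx.sub_const (f₀ x)).abs
      refine squeeze_zero (fun n => by positivity) (fun n => min_le_left _ _) h0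
  have h2 : Tendsto (fun n => ∫ x, max (g₀ x - g n x) 0 ∂P) atTop (𝓝 0) := by
    have := tendsto_integral_of_dominated_convergence (μ := P)
      (F := fun n x => max (g₀ x - g n x) 0) (f := fun _ => (0 : ℝ))
      (fun x => |g₀ x|) (fun n => (hpos n).aestronglyMeasurable) hg₀.abs
      (fun n => Eventually.of_forall fun x => ?_) ?_
    · simpa using this
    · rw [Real.norm_of_nonneg (le_max_right _ _)]
      refine max_le ?_ (abs_nonneg _)
      linarith [(abs_nonneg _).trans (hfg n x), le_abs_self (g₀ x)]
    · filter_upwards [hglim] with x hx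
      simpa using (hx.const_sub (g₀ x)).max (tendsto_const_nhds (x := (0 : ℝ)))
  have h3 : Tendsto (fun n => (∫ x, min |f n x - f₀ x| (|g₀ x| + |f₀ x|) ∂P)
      + ((∫ x, g n x ∂P - ∫ x, g₀ x ∂P) + ∫ x, max (g₀ x - g n x) 0 ∂P)) atTop (𝓝 0) := by
    simpa using h1.add ((hint.sub_const (∫ x, g₀ x ∂P)).add h2)
  refine squeeze_zero (fun n => integral_nonneg fun x => abs_nonneg _) (fun n => ?_) h3
  have hs : Integrable (fun x => g n x - g₀ x) P := (hg n).sub hg₀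
  have ht : Integrable (fun x => (g n x - g₀ x) + max (g₀ x - g n x) 0) P := hs.add (hpos n)
  have hu : Integrable (fun x => min |f n x - f₀ x| (|g₀ x| + |f₀ x|)) P := (hd n).inf hG
  rw [← integral_sub (hg n) hg₀, ← integral_add hs (hpos n), ← integral_add hu ht]
  refine integral_mono (hd n) (hu.add ht) fun x => ?_
  change _ ≤ min _ _ + _
  have e1 := hfg n x
  have e2 : |f n x - f₀ x| ≤ |f n x| + |f₀ x| := abs_sub _ _
  have e3 := le_abs_self (g₀ x)
  have e4 := le_max_left (g₀ x - g n x) 0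
  have e5 := le_max_right (g₀ x - g n x) 0
  -- When the truncation is active, the excess is at most `|f_n| - |g₀| ≤ g_n - g₀`.
  rcases le_total |f n x - f₀ x| (|g₀ x| + |f₀ x|) with h | h
  · rw [min_eq_left h]; linarith
  · rw [min_eq_right h]; linarith

end Domination

/-! ### Measures with bounded support and their `L^p` norms -/

section Norms

theorem eLpNorm_eq_lintegral_abs_rpow {Ω : Type*} [MeasurableSpace Ω] {P : Measure Ω} {p : ℝ}
    (hp : 0 < p) (f : Ω → ℝ) :
    eLpNorm f (ENNReal.ofReal p) P = (∫⁻ x, ENNReal.ofReal (|f x| ^ p) ∂P) ^ (1 / p) := by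
  rw [eLpNorm_eq_lintegral_rpow_enorm_toReal (by simpa using hp) ENNReal.ofReal_ne_top,
    ENNReal.toReal_ofReal hp.le]
  congr 2
  funext x
  rw [Real.enorm_eq_ofReal_abs, ENNReal.ofReal_rpow_of_nonneg (abs_nonneg _) hp.le]

theorem toReal_eLpNorm_pow {Ω : Type*} [MeasurableSpace Ω] {P : Measure Ω} {m : ℕ}
    (hm : 0 < m) (hm' : Even m) {f : Ω → ℝ} (hf : AEStronglyMeasurable f P) :
    (eLpNorm f (ENNReal.ofReal m) P).toReal ^ m = ∫ x, f x ^ m ∂P := by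
  have hm0 : (0 : ℝ) < m := by exact_mod_cast hm
  rw [eLpNorm_eq_lintegral_abs_rpow hm0, ← ENNReal.toReal_rpow, ← Real.rpow_natCast,
    ← Real.rpow_mul ENNReal.toReal_nonneg, one_div_mul_cancel hm0.ne', Real.rpow_one,
    integral_eq_lintegral_of_nonneg_ae]
  · simp only [Real.rpow_natCast, hm'.pow_abs]
  · exact Eventually.of_forall fun x => hm'.pow_nonneg _
  · exact hf.pow m

variable {μ : ProbabilityMeasure ℝ}

theorem memLp_id_of_bounded (h : ∃ C, ∀ᵐ x ∂(μ : Measure ℝ), |x| ≤ C) (p : ℝ≥0∞) :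
    MemLp (fun x : ℝ => x) p (μ : Measure ℝ) := by
  obtain ⟨C, hC⟩ := h
  exact MemLp.of_bound (by fun_prop) C hC

theorem inWassersteinSpace_of_bounded (h : ∃ C, ∀ᵐ x ∂(μ : Measure ℝ), |x| ≤ C) {p : ℝ}
    (hp : 0 < p) : InWassersteinSpace p μ := by
  have h1 := (memLp_id_of_bounded h (ENNReal.ofReal p)).eLpNorm_lt_top
  rw [eLpNorm_eq_lintegral_abs_rpow hp] at h1
  exact (ENNReal.rpow_lt_top_iff_of_pos (by positivity)).1 h1

theorem integrable_of_bounded (h : ∃ C, ∀ᵐ x ∂(μ : Measure ℝ), |x| ≤ C) {f : ℝ → ℝ}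
    (hf : Continuous f) : Integrable f (μ : Measure ℝ) := by
  obtain ⟨C, hC⟩ := h
  obtain ⟨K, hK⟩ := (isCompact_Icc (a := -C) (b := C)).exists_bound_of_continuousOn hf.continuousOn
  refine Integrable.of_bound hf.aestronglyMeasurable K ?_
  filter_upwards [hC] with x hx using hK x (abs_le.1 hx)

theorem integrable_comp_invDistFun (h : ∃ C, ∀ᵐ x ∂(μ : Measure ℝ), |x| ≤ C) {f : ℝ → ℝ}
    (hf : Continuous f) :
    Integrable (fun x => f (invDistFun μ x)) (volume.restrict (Set.Icc 0 1)) := by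
  have h1 := integrable_of_bounded h hf
  rw [← map_invDistFun μ] at h1
  exact h1.comp_aemeasurable (aemeasurable_invDistFun μ)

theorem memLp_invDistFun (h : ∃ C, ∀ᵐ x ∂(μ : Measure ℝ), |x| ≤ C) (p : ℝ≥0∞) :
    MemLp (invDistFun μ) p (volume.restrict (Set.Icc 0 1)) := by
  have h1 := memLp_id_of_bounded h p
  rw [← map_invDistFun μ] at h1
  exact h1.comp_of_map (aemeasurable_invDistFun μ)

/-- The two quantile functions on a common uniform variable form a coupling; its optimality is not
needed. -/
theorem wassersteinDist_le_eLpNorm_invDistFun (μ ν : ProbabilityMeasure ℝ) {p : ℝ} (hp : 0 < p) :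
    wassersteinDist p μ ν ≤
      eLpNorm (invDistFun μ - invDistFun ν) (ENNReal.ofReal p) (volume.restrict (Set.Icc 0 1)) := by
  have hm : AEMeasurable (fun x => (invDistFun μ x, invDistFun ν x))
      ((volume : Measure ℝ).restrict (Set.Icc 0 1)) :=
    (aemeasurable_invDistFun μ).prodMk (aemeasurable_invDistFun ν)
  refine iInf₂_le_of_le ((volume.restrict (Set.Icc 0 1)).map
    fun x => (invDistFun μ x, invDistFun ν x)) ⟨?_, ?_⟩ ?_
  · rw [AEMeasurable.map_map_of_aemeasurable measurable_fst.aemeasurable hm]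
    exact map_invDistFun μ
  · rw [AEMeasurable.map_map_of_aemeasurable measurable_snd.aemeasurable hm]
    exact map_invDistFun ν
  · rw [eLpNorm_eq_lintegral_abs_rpow hp, lintegral_map' (by fun_prop) hm]
    rfl

theorem wassersteinDist_comm (p : ℝ) (μ ν : ProbabilityMeasure ℝ) :
    wassersteinDist p μ ν = wassersteinDist p ν μ := by
  have key (μ ν : ProbabilityMeasure ℝ) : wassersteinDist p μ ν ≤ wassersteinDist p ν μ := by
    refine le_iInf₂ fun γ hγ => iInf₂_le_of_le (γ.map Prod.swap) ⟨?_, ?_⟩ ?_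
    · rw [Measure.map_map measurable_fst measurable_swap]; exact hγ.2
    · rw [Measure.map_map measurable_snd measurable_swap]; exact hγ.1
    · rw [lintegral_map (by fun_prop) measurable_swap]
      simp only [Prod.fst_swap, Prod.snd_swap, abs_sub_comm]
      exact le_rfl
  exact le_antisymm (key μ ν) (key ν μ)

/-- Minkowski's inequality for `z.1 = z.2 + (z.1 - z.2)` under an arbitrary coupling. -/
theorem eLpNorm_id_le_add_wassersteinDist (μ ν : ProbabilityMeasure ℝ) {p : ℝ} (hp : 1 ≤ p) :
    eLpNorm (fun x : ℝ => x) (ENNReal.ofReal p) (μ : Measure ℝ)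
      ≤ eLpNorm (fun x : ℝ => x) (ENNReal.ofReal p) (ν : Measure ℝ) + wassersteinDist p μ ν := by
  rw [wassersteinDist, ENNReal.add_iInf₂]
  refine le_iInf₂ fun γ hγ => ?_
  rw [← eLpNorm_eq_lintegral_abs_rpow (by linarith) fun z : ℝ × ℝ => z.1 - z.2, ← hγ.1, ← hγ.2,
    eLpNorm_map_measure (by fun_prop) (by fun_prop), eLpNorm_map_measure (by fun_prop) (by fun_prop)]
  have h := eLpNorm_add_le (f := fun z : ℝ × ℝ => z.2) (g := fun z : ℝ × ℝ => z.1 - z.2) (μ := γ)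
    (p := ENNReal.ofReal p) (by fun_prop) (by fun_prop) (by simpa using hp)
  refine le_trans (le_of_eq ?_) h
  congr 1
  funext z
  simp

end Norms

/-! ### Convergence of moments, quantiles and Wasserstein distances -/

section Convergence

variable {μ : ℕ → ProbabilityMeasure ℝ} {ν : ProbabilityMeasure ℝ} {m : ℕ}

theorem tendsto_integral_pow_of_tendsto_wassersteinDist
    (hν : ∃ C, ∀ᵐ x ∂(ν : Measure ℝ), |x| ≤ C) (hm : 0 < m) (hm' : Even m)
    (h : Tendsto (fun n => wassersteinDist m (μ n) ν) atTop (𝓝 0)) :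
    Tendsto (fun n => ∫ x, x ^ m ∂(μ n : Measure ℝ)) atTop (𝓝 (∫ x, x ^ m ∂(ν : Measure ℝ))) := by
  have hm1 : (1 : ℝ) ≤ m := by exact_mod_cast hm
  have hfin := (memLp_id_of_bounded hν (ENNReal.ofReal m)).eLpNorm_ne_top
  have key : Tendsto (fun n => eLpNorm (fun x : ℝ => x) (ENNReal.ofReal m) (μ n : Measure ℝ)) atTop
      (𝓝 (eLpNorm (fun x : ℝ => x) (ENNReal.ofReal m) (ν : Measure ℝ))) := by
    refine tendsto_of_tendsto_of_tendsto_of_le_of_le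
      (g := fun n => eLpNorm (fun x : ℝ => x) (ENNReal.ofReal m) (ν : Measure ℝ)
        - wassersteinDist m (μ n) ν)
      (h := fun n => eLpNorm (fun x : ℝ => x) (ENNReal.ofReal m) (ν : Measure ℝ)
        + wassersteinDist m (μ n) ν) ?_ ?_ (fun n => ?_) (fun n => ?_)
    · simpa using ENNReal.Tendsto.sub (tendsto_const_nhds (x :=
        eLpNorm (fun x : ℝ => x) (ENNReal.ofReal m) (ν : Measure ℝ))) h (Or.inl hfin)
    · simpa using (tendsto_const_nhds (x :=
        eLpNorm (fun x : ℝ => x) (ENNReal.ofReal m) (ν : Measure ℝ))).add h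
    · refine tsub_le_iff_right.2 ?_
      rw [wassersteinDist_comm]
      exact eLpNorm_id_le_add_wassersteinDist ν (μ n) hm1
    · exact eLpNorm_id_le_add_wassersteinDist (μ n) ν hm1
  have h2 := ((ENNReal.tendsto_toReal hfin).comp key).pow m
  simp only [Function.comp] at h2
  rw [toReal_eLpNorm_pow hm hm' (by fun_prop)] at h2
  refine h2.congr fun n => toReal_eLpNorm_pow hm hm' (by fun_prop)

theorem tendstoWasserstein_of_tendstoLpUnitInterval
    (hμ : ∀ n, ∃ C, ∀ᵐ x ∂(μ n : Measure ℝ), |x| ≤ C) (hν : ∃ C, ∀ᵐ x ∂(ν : Measure ℝ), |x| ≤ C)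
    {p : ℝ} (hp : 1 ≤ p)
    (h : TendstoLpUnitInterval p (fun n => invDistFun (μ n)) (invDistFun ν)) :
    TendstoWasserstein p μ ν := by
  have hp0 : 0 < p := by linarith
  exact ⟨fun n => inWassersteinSpace_of_bounded (hμ n) hp0, inWassersteinSpace_of_bounded hν hp0,
    tendsto_of_tendsto_of_tendsto_of_le_of_le tendsto_const_nhds h.2.2 (fun n => zero_le)
      fun n => wassersteinDist_le_eLpNorm_invDistFun (μ n) ν hp0⟩

variable [NullSingletonClass (ν : Measure ℝ)]

/-- Transported to quantiles, `|x|^k ≤ 1 + x^m` is a varying bound whose integrals converge. -/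
theorem tendsto_integral_pow_of_le (hw : Tendsto μ atTop (𝓝 ν))
    (hμ : ∀ n, ∃ C, ∀ᵐ x ∂(μ n : Measure ℝ), |x| ≤ C) (hν : ∃ C, ∀ᵐ x ∂(ν : Measure ℝ), |x| ≤ C)
    (hm' : Even m)
    (h : Tendsto (fun n => ∫ x, x ^ m ∂(μ n : Measure ℝ)) atTop
      (𝓝 (∫ x, x ^ m ∂(ν : Measure ℝ)))) {k : ℕ} (hk : k ≤ m) :
    Tendsto (fun n => ∫ x, x ^ k ∂(μ n : Measure ℝ)) atTop (𝓝 (∫ x, x ^ k ∂(ν : Measure ℝ))) := by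
  have hck : Continuous fun x : ℝ => x ^ k := by fun_prop
  have hcg : Continuous fun x : ℝ => 1 + x ^ m := by fun_prop
  have hint : ∀ ρ : ProbabilityMeasure ℝ, (∃ C, ∀ᵐ x ∂(ρ : Measure ℝ), |x| ≤ C) →
      ∫ x in Set.Icc (0 : ℝ) 1, (1 + invDistFun ρ x ^ m) = 1 + ∫ x, x ^ m ∂(ρ : Measure ℝ) := by
    intro ρ hρ
    rw [integral_comp_invDistFun ρ hcg, integral_add (integrable_const _)
      (integrable_of_bounded hρ (by fun_prop))]
    simp
  have hae := ae_tendsto_invDistFun hw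
  have hlim := tendsto_integral_abs_sub_of_tendsto_bound
    (P := volume.restrict (Set.Icc (0 : ℝ) 1))
    (f := fun n x => invDistFun (μ n) x ^ k) (f₀ := fun x => invDistFun ν x ^ k)
    (g := fun n x => 1 + invDistFun (μ n) x ^ m) (g₀ := fun x => 1 + invDistFun ν x ^ m)
    (fun n => (integrable_comp_invDistFun (hμ n) hck).aestronglyMeasurable)
    (integrable_comp_invDistFun hν hck) (fun n => integrable_comp_invDistFun (hμ n) hcg)
    (integrable_comp_invDistFun hν hcg) (fun n x => ?_)
    (by filter_upwards [hae] with x hx using hx.pow k)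
    (by filter_upwards [hae] with x hx using (hx.pow m).const_add 1) ?_
  · rw [tendsto_iff_norm_sub_tendsto_zero]
    refine squeeze_zero (fun n => norm_nonneg _) (fun n => ?_) hlim
    rw [← integral_comp_invDistFun (μ n) hck, ← integral_comp_invDistFun ν hck,
      ← integral_sub (integrable_comp_invDistFun (hμ n) hck) (integrable_comp_invDistFun hν hck)]
    exact norm_integral_le_integral_norm _
  · rw [abs_pow, ← hm'.pow_abs (invDistFun (μ n) x)]
    have h0 := abs_nonneg (invDistFun (μ n) x)
    rcases le_total |invDistFun (μ n) x| 1 with h1 | h1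
    · linarith [pow_le_one₀ (n := k) h0 h1, pow_nonneg h0 m]
    · linarith [pow_le_pow_right₀ h1 hk]
  · simp only [hint _ hν, hint _ (hμ _)]
    exact h.const_add 1

/-- The varying bound is `(a - b)^m ≤ 2^(m-1) (a^m + b^m)`. Exponents below `m` follow by
monotonicity of norms on a probability space. -/
theorem tendstoLpUnitInterval_of_tendsto_integral_pow (hw : Tendsto μ atTop (𝓝 ν))
    (hμ : ∀ n, ∃ C, ∀ᵐ x ∂(μ n : Measure ℝ), |x| ≤ C) (hν : ∃ C, ∀ᵐ x ∂(ν : Measure ℝ), |x| ≤ C)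
    (hm : 0 < m) (hm' : Even m)
    (h : Tendsto (fun n => ∫ x, x ^ m ∂(μ n : Measure ℝ)) atTop
      (𝓝 (∫ x, x ^ m ∂(ν : Measure ℝ)))) {p : ℝ} (hpm : p ≤ m) :
    TendstoLpUnitInterval p (fun n => invDistFun (μ n)) (invDistFun ν) := by
  refine ⟨fun n => memLp_invDistFun (hμ n) _, memLp_invDistFun hν _, ?_⟩
  set P := (volume : Measure ℝ).restrict (Set.Icc 0 1) with hP
  have hmem (n : ℕ) : MemLp (invDistFun (μ n) - invDistFun ν) (ENNReal.ofReal m) P :=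
    (memLp_invDistFun (hμ n) _).sub (memLp_invDistFun hν _)
  suffices hmain : Tendsto (fun n => eLpNorm (invDistFun (μ n) - invDistFun ν)
      (ENNReal.ofReal m) P) atTop (𝓝 0) by
    refine tendsto_of_tendsto_of_tendsto_of_le_of_le tendsto_const_nhds hmain
      (fun n => zero_le) fun n => ?_
    exact eLpNorm_le_eLpNorm_of_exponent_le (ENNReal.ofReal_le_ofReal hpm) (hmem n).1
  have hcm : Continuous fun x : ℝ => x ^ m := by fun_prop
  have hae := ae_tendsto_invDistFun hw
  have hIμ (n : ℕ) : Integrable (fun x => invDistFun (μ n) x ^ m) P :=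
    integrable_comp_invDistFun (hμ n) hcm
  have hIν : Integrable (fun x => invDistFun ν x ^ m) P := integrable_comp_invDistFun hν hcm
  have hlim := tendsto_integral_abs_sub_of_tendsto_bound (P := P)
    (f := fun n x => (invDistFun (μ n) x - invDistFun ν x) ^ m) (f₀ := fun _ => 0)
    (g := fun n x => 2 ^ (m - 1) * (invDistFun (μ n) x ^ m + invDistFun ν x ^ m))
    (g₀ := fun x => 2 ^ (m - 1) * (invDistFun ν x ^ m + invDistFun ν x ^ m))
    (fun n => (hmem n).1.pow m) (integrable_zero _ _ _)
    (fun n => ((hIμ n).add hIν).const_mul _)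
    ((hIν.add hIν).const_mul _) (fun n x => ?_)
    (by
      filter_upwards [hae] with x hx
      simpa [hm.ne'] using (hx.sub_const (invDistFun ν x)).pow m)
    (by filter_upwards [hae] with x hx using ((hx.pow m).add_const _).const_mul _) ?_
  · have h1 : Tendsto (fun n => (eLpNorm (invDistFun (μ n) - invDistFun ν)
        (ENNReal.ofReal m) P).toReal ^ m) atTop (𝓝 0) := by
      refine hlim.congr fun n => ?_
      rw [toReal_eLpNorm_pow hm hm' (hmem n).1]
      simp only [sub_zero, Pi.sub_apply, abs_pow, hm'.pow_abs]
    have h2 : Tendsto (fun n => (eLpNorm (invDistFun (μ n) - invDistFun ν)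
        (ENNReal.ofReal m) P).toReal) atTop (𝓝 0) := by
      have h3 := h1.rpow_const (p := (m : ℝ)⁻¹) (Or.inr (by positivity))
      rw [Real.zero_rpow (by positivity)] at h3
      exact h3.congr fun n => Real.pow_rpow_inv_natCast ENNReal.toReal_nonneg hm.ne'
    rw [← ENNReal.toReal_zero] at h2
    exact (ENNReal.tendsto_toReal_iff (fun n => (hmem n).eLpNorm_ne_top) ENNReal.zero_ne_top).1 h2
  · rw [abs_pow]
    refine (pow_le_pow_left₀ (abs_nonneg _) (abs_sub _ _) m).trans ?_
    refine (add_pow_le (abs_nonneg _) (abs_nonneg _) m).trans ?_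
    rw [hm'.pow_abs, hm'.pow_abs]
  · simp only [integral_const_mul, integral_add (hIμ _) hIν, integral_add hIν hIν]
    have e (ρ : ProbabilityMeasure ℝ) :
      ∫ x, invDistFun ρ x ^ m ∂P = ∫ x, x ^ m ∂(ρ : Measure ℝ) := integral_comp_invDistFun ρ hcm
    simp only [e]
    exact (h.add_const _).const_mul _

end Convergence

/-! ### Monomials versus Chebyshev polynomials -/

section Chebyshev

open Polynomial

variable {μ : ℕ → ProbabilityMeasure ℝ} {ν : ProbabilityMeasure ℝ} {m : ℕ}

/-- The integrals of the polynomial `P` converge. -/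
def TendstoIntegral (μ : ℕ → ProbabilityMeasure ℝ) (ν : ProbabilityMeasure ℝ) (P : ℝ[X]) : Prop :=
  Tendsto (fun n => ∫ x, P.eval x ∂(μ n : Measure ℝ)) atTop (𝓝 (∫ x, P.eval x ∂(ν : Measure ℝ)))

theorem TendstoIntegral.add (hμ : ∀ n, ∃ C, ∀ᵐ x ∂(μ n : Measure ℝ), |x| ≤ C)
    (hν : ∃ C, ∀ᵐ x ∂(ν : Measure ℝ), |x| ≤ C) {P Q : ℝ[X]} (hP : TendstoIntegral μ ν P)
    (hQ : TendstoIntegral μ ν Q) : TendstoIntegral μ ν (P + Q) := by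
  have key (ρ : ProbabilityMeasure ℝ) (hρ : ∃ C, ∀ᵐ x ∂(ρ : Measure ℝ), |x| ≤ C) :
      ∫ x, (P + Q).eval x ∂(ρ : Measure ℝ)
        = ∫ x, P.eval x ∂(ρ : Measure ℝ) + ∫ x, Q.eval x ∂(ρ : Measure ℝ) := by
    simp only [eval_add]
    exact integral_add (integrable_of_bounded hρ P.continuous)
      (integrable_of_bounded hρ Q.continuous)
  unfold TendstoIntegral
  rw [key ν hν]
  exact (Tendsto.add hP hQ).congr fun n => (key (μ n) (hμ n)).symm

theorem TendstoIntegral.neg {P : ℝ[X]} (hP : TendstoIntegral μ ν P) :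
    TendstoIntegral μ ν (-P) := by
  unfold TendstoIntegral
  simp only [eval_neg, integral_neg]
  exact Tendsto.neg hP

/-- The extra factor `X^k` makes the induction close: the recurrence lowers the Chebyshev index
while raising the power of `X`, with total degree at most `m`. -/
theorem tendstoIntegral_chebyshevS (hμ : ∀ n, ∃ C, ∀ᵐ x ∂(μ n : Measure ℝ), |x| ≤ C)
    (hν : ∃ C, ∀ᵐ x ∂(ν : Measure ℝ), |x| ≤ C)
    (h : ∀ k ≤ m, TendstoIntegral μ ν (X ^ k)) (j : ℕ) :
    ∀ k, j + k ≤ m → TendstoIntegral μ ν (X ^ k * Chebyshev.S ℝ j) := by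
  induction j using Nat.twoStepInduction with
  | zero => exact fun k hk => by simpa using h k (by omega)
  | one => exact fun k hk => by simpa [← pow_succ] using h (k + 1) (by omega)
  | more j ih1 ih2 =>
    intro k hk
    have e : (X ^ k * Chebyshev.S ℝ ((j + 2 : ℕ) : ℤ) : ℝ[X])
        = X ^ (k + 1) * Chebyshev.S ℝ ((j + 1 : ℕ) : ℤ) + -(X ^ k * Chebyshev.S ℝ (j : ℤ)) := by
      push_cast
      rw [Chebyshev.S_add_two]; ring
    rw [e]
    exact (ih2 (k + 1) (by omega)).add hμ hν (ih1 k (by omega)).neg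

/-- The reverse trade: `X S_{j+1} = S_{j+2} + S_j`, and `X S_0 = S_1`, remove powers of `X`. -/
theorem tendstoIntegral_pow (hμ : ∀ n, ∃ C, ∀ᵐ x ∂(μ n : Measure ℝ), |x| ≤ C)
    (hν : ∃ C, ∀ᵐ x ∂(ν : Measure ℝ), |x| ≤ C)
    (h : ∀ j : ℕ, j ≤ m → TendstoIntegral μ ν (Chebyshev.S ℝ j)) (k : ℕ) :
    ∀ j : ℕ, j + k ≤ m → TendstoIntegral μ ν (X ^ k * Chebyshev.S ℝ j) := by
  induction k with
  | zero => exact fun j hj => by simpa using h j (by omega)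
  | succ k ih =>
    intro j hj
    rcases j with _ | j
    · simpa [pow_succ] using ih 1 (by omega)
    · have e : (X ^ (k + 1) * Chebyshev.S ℝ ((j + 1 : ℕ) : ℤ) : ℝ[X])
          = X ^ k * Chebyshev.S ℝ ((j + 2 : ℕ) : ℤ) + X ^ k * Chebyshev.S ℝ (j : ℤ) := by
        push_cast
        rw [Chebyshev.S_add_two]; ring
      rw [e]
      exact (ih (j + 2) (by omega)).add hμ hν (ih j (by omega))

end Chebyshev

/-! ### The main equivalence -/

namespace Multigraph

theorem ae_abs_le_spectralMeasure {V D : Type*} [Fintype V] [DecidableEq V]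
    (G : Multigraph V D) (q : ℕ) : ∃ C, ∀ᵐ x ∂(G.spectralMeasure q), |x| ≤ C := by
  refine ⟨∑ k, |(Real.sqrt q)⁻¹ * G.adjMatrix_isHermitian.eigenvalues k|, ?_⟩
  refine Measure.ae_smul_measure ?_ _
  rw [ae_finsetSum_measure_iff]
  intro k _
  rw [ae_dirac_eq]
  exact Finset.single_le_sum
    (f := fun k => |(Real.sqrt q)⁻¹ * G.adjMatrix_isHermitian.eigenvalues k|)
    (fun _ _ => abs_nonneg _) (Finset.mem_univ k)

/-- The normalized count `q^{-r/2} N / |V|`. -/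
noncomputable def normalizedCount (V : Type*) [Fintype V] (q r N : ℕ) : ℝ :=
  (q : ℝ) ^ (-((r : ℝ) / 2)) * ((N : ℝ) / (Fintype.card V : ℝ))

theorem normalizedCount_nonneg (V : Type*) [Fintype V] (q r N : ℕ) :
    0 ≤ normalizedCount V q r N := by
  unfold normalizedCount; positivity

/-- Lengthening by two costs a factor `q⁻¹`, which cancels the `q` in front of the closed walks and
damps the shorter circuits. -/
theorem normalizedCount_recursion {V D : Type*} [Fintype V] [DecidableEq V] [Finite D]
    (G : Multigraph V D) {q : ℕ} (hq : 1 ≤ q) (hG : G.IsRegular (q + 1)) (r : ℕ) :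
    normalizedCount V q (r + 3) (G.numClosedNBW (r + 3))
        - normalizedCount V q (r + 3) (G.numCircuits (r + 3))
      = normalizedCount V q (r + 1) (G.numClosedNBW (r + 1))
        - (q : ℝ)⁻¹ * normalizedCount V q (r + 1) (G.numCircuits (r + 1)) := by
  classical
  have := Fintype.ofFinite D
  have hq' : (0 : ℝ) < q := by exact_mod_cast hq
  have h := G.numClosedNBW_sub_numCircuits hG r
  have hp : (q : ℝ) ^ (-(((r + 3 : ℕ) : ℝ) / 2))
      = (q : ℝ)⁻¹ * (q : ℝ) ^ (-(((r + 1 : ℕ) : ℝ) / 2)) := by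
    rw [← Real.rpow_neg_one, ← Real.rpow_add hq']
    congr 1; push_cast; ring
  unfold normalizedCount
  rw [hp, ← mul_sub, ← sub_div, h]
  field_simp

variable {V D : ℕ → Type*} [∀ n, Fintype (V n)] [∀ n, DecidableEq (V n)] [∀ n, Finite (D n)]
  (G : ∀ n, Multigraph (V n) (D n)) {q : ℕ → ℕ} {m : ℕ}

theorem tendsto_inv_natCast (h : Tendsto q atTop atTop) :
    Tendsto (fun n => (q n : ℝ)⁻¹) atTop (𝓝 0) :=
  tendsto_inv_atTop_zero.comp (tendsto_natCast_atTop_atTop.comp h)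

theorem tendsto_numCircuits_iff (hq : ∀ n, 1 ≤ q n) (hG : ∀ n, (G n).IsRegular (q n + 1))
    (hinf : Tendsto q atTop atTop) :
    (∀ r ∈ Finset.Icc 1 m, Tendsto (fun n =>
        normalizedCount (V n) (q n) r ((G n).numCircuits r)) atTop (𝓝 0)) ↔
      ∀ r ∈ Finset.Icc 1 m, Tendsto (fun n =>
        normalizedCount (V n) (q n) r ((G n).numClosedNBW r)) atTop (𝓝 0) := by
  classical
  have (n : ℕ) := Fintype.ofFinite (D n)
  have hinv := tendsto_inv_natCast hinf
  have h1 (n : ℕ) := (G n).numClosedNBW_one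
  have h2 (n : ℕ) := (G n).numClosedNBW_two
  have hrec (r n : ℕ) := normalizedCount_recursion (G n) (hq n) (hG n) r
  simp only [Finset.mem_Icc, and_imp]
  constructor
  · intro h
    have key (r : ℕ) : r + 1 ≤ m → Tendsto (fun n =>
        normalizedCount (V n) (q n) (r + 1) ((G n).numClosedNBW (r + 1))) atTop (𝓝 0) := by
      induction r using Nat.twoStepInduction with
      | zero => exact fun hr => by simpa [h1] using h 1 le_rfl hr
      | one => exact fun hr => by simpa [h2] using h 2 (by norm_num) hr
      | more r ih1 _ =>
        intro hr
        have ha := (h (r + 3) (by omega) hr).add ((ih1 (by omega)).sub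
          (hinv.mul (h (r + 1) (by omega) (by omega))))
        simp only [mul_zero, sub_zero, add_zero] at ha
        exact ha.congr fun n => by rw [← hrec]; ring
    intro r hr hrm
    obtain ⟨r, rfl⟩ := Nat.exists_eq_add_of_le' hr
    exact key r hrm
  · intro h
    have key (r : ℕ) : r + 1 ≤ m → Tendsto (fun n =>
        normalizedCount (V n) (q n) (r + 1) ((G n).numCircuits (r + 1))) atTop (𝓝 0) := by
      induction r using Nat.twoStepInduction with
      | zero => exact fun hr => by simpa [h1] using h 1 le_rfl hr
      | one => exact fun hr => by simpa [h2] using h 2 (by norm_num) hr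
      | more r ih1 _ =>
        intro hr
        have ha := (h (r + 3) (by omega) hr).sub ((h (r + 1) (by omega) (by omega)).sub
          (hinv.mul (ih1 (by omega))))
        simp only [mul_zero, sub_zero] at ha
        exact ha.congr fun n => by rw [← hrec]; ring
    intro r hr hrm
    obtain ⟨r, rfl⟩ := Nat.exists_eq_add_of_le' hr
    exact key r hrm

open Polynomial

variable [∀ n, Nonempty (V n)]

theorem bounded_spectralLaw (n : ℕ) :
    ∃ C, ∀ᵐ x ∂((G n).spectralLaw (q n) : Measure ℝ), |x| ≤ C :=
  (G n).ae_abs_le_spectralMeasure (q n)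

theorem bounded_semicircleLaw : ∃ C, ∀ᵐ x ∂(semicircleLaw : Measure ℝ), |x| ≤ C :=
  ⟨2, ae_abs_le_semicircleMeasure⟩

instance : NullSingletonClass (semicircleLaw : Measure ℝ) :=
  inferInstanceAs (NullSingletonClass semicircleMeasure)

theorem tendstoIntegral_chebyshevS_succ_iff (r : ℕ) :
    TendstoIntegral (fun n => (G n).spectralLaw (q n)) semicircleLaw
        (Chebyshev.S ℝ ((r + 1 : ℕ) : ℤ)) ↔
      Tendsto (fun n => ∫ x, (Chebyshev.S ℝ ((r : ℤ) + 1)).eval x ∂((G n).spectralMeasure (q n)))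
        atTop (𝓝 0) := by
  have h : ∫ x, (Chebyshev.S ℝ ((r : ℤ) + 1)).eval x ∂(semicircleLaw : Measure ℝ) = 0 :=
    integral_chebyshevS_semicircleMeasure r
  rw [TendstoIntegral, Nat.cast_add_one, h]
  rfl

theorem tendstoIntegral_chebyshevS_zero :
    TendstoIntegral (fun n => (G n).spectralLaw (q n)) semicircleLaw
      (Chebyshev.S ℝ ((0 : ℕ) : ℤ)) := by
  simp [TendstoIntegral]

theorem normalizedCount_eq_integral (hq : ∀ n, 1 ≤ q n) (hG : ∀ n, (G n).IsRegular (q n + 1))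
    (r n : ℕ) : normalizedCount (V n) (q n) (r + 1) ((G n).numClosedNBW (r + 1))
      = ∫ x, (Chebyshev.S ℝ ((r : ℤ) + 1)).eval x ∂((G n).spectralMeasure (q n)) - (q n : ℝ)⁻¹ *
        ∫ x, (Chebyshev.S ℝ ((r : ℤ) - 1)).eval x ∂((G n).spectralMeasure (q n)) := by
  classical
  have := Fintype.ofFinite (D n)
  exact (G n).numClosedNBW_eq_integral (hq n) (hG n) r

/-- The correction involving the index two lower is `q⁻¹` times a sequence convergent by induction,
so it vanishes whatever its limit (which is `1` for `S_0`). -/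
theorem tendstoIntegral_chebyshevS_of_numClosedNBW (hq : ∀ n, 1 ≤ q n)
    (hG : ∀ n, (G n).IsRegular (q n + 1)) (hinf : Tendsto q atTop atTop)
    (h : ∀ r ∈ Finset.Icc 1 m, Tendsto (fun n =>
        normalizedCount (V n) (q n) r ((G n).numClosedNBW r)) atTop (𝓝 0)) (j : ℕ) :
    j ≤ m → TendstoIntegral (fun n => (G n).spectralLaw (q n)) semicircleLaw
      (Chebyshev.S ℝ (j : ℤ)) := by
  have hinv := tendsto_inv_natCast hinf
  have hrec := normalizedCount_eq_integral G hq hG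
  induction j using Nat.twoStepInduction with
  | zero => exact fun _ => tendstoIntegral_chebyshevS_zero G
  | one =>
    intro h1
    rw [tendstoIntegral_chebyshevS_succ_iff G 0]
    refine (h 1 (by simpa using h1)).congr fun n => ?_
    rw [hrec 0 n]
    simp
  | more j ih _ =>
    intro hj
    rw [tendstoIntegral_chebyshevS_succ_iff G (j + 1)]
    have ha := (h (j + 2) (by simpa using hj)).add (hinv.mul (ih (by omega)))
    rw [zero_mul, add_zero] at ha
    refine ha.congr fun n => ?_
    rw [hrec (j + 1) n]
    simp [spectralLaw]

theorem tendsto_numClosedNBW_of_chebyshevS (hq : ∀ n, 1 ≤ q n)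
    (hG : ∀ n, (G n).IsRegular (q n + 1)) (hm : 2 ≤ m)
    (h : ∀ j : ℕ, j ≤ m → TendstoIntegral (fun n => (G n).spectralLaw (q n)) semicircleLaw
      (Chebyshev.S ℝ (j : ℤ))) :
    Tendsto q atTop atTop ∧ ∀ r ∈ Finset.Icc 1 m, Tendsto (fun n =>
        normalizedCount (V n) (q n) r ((G n).numClosedNBW r)) atTop (𝓝 0) := by
  have hrec := normalizedCount_eq_integral G hq hG
  -- Nonnegativity of the count at length two reads `q⁻¹ ≤ ∫ S_2`, since `S_0 = 1`.
  have hinv : Tendsto (fun n => (q n : ℝ)⁻¹) atTop (𝓝 0) := by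
    refine squeeze_zero (fun n => by positivity) (fun n => ?_)
      ((tendstoIntegral_chebyshevS_succ_iff G 1).1 (h 2 hm))
    have h1 := hrec 1 n
    have h2 := normalizedCount_nonneg (V n) (q n) 2 ((G n).numClosedNBW 2)
    simp only [Nat.cast_one, sub_self, Chebyshev.S_zero, eval_one, integral_const, probReal_univ,
      smul_eq_mul, mul_one] at h1
    rw [h1] at h2
    simpa using h2
  have hinf : Tendsto q atTop atTop := by
    rw [← tendsto_natCast_atTop_iff (R := ℝ)]
    have h1 : Tendsto (fun n => (q n : ℝ)⁻¹) atTop (𝓝[>] 0) := by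
      refine tendsto_nhdsWithin_iff.2 ⟨hinv, Eventually.of_forall fun n => ?_⟩
      have := hq n
      exact Set.mem_Ioi.2 (by positivity)
    exact h1.inv_tendsto_nhdsGT_zero.congr fun n => by simp
  refine ⟨hinf, fun r hr => ?_⟩
  obtain ⟨hr1, hr2⟩ := Finset.mem_Icc.1 hr
  obtain ⟨r, rfl⟩ := Nat.exists_eq_add_of_le' hr1
  have ha := (tendstoIntegral_chebyshevS_succ_iff G r).1 (h (r + 1) hr2)
  rcases r with _ | r
  · refine ha.congr fun n => ?_
    rw [hrec 0 n]
    simp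
  · have hb := ha.sub (hinv.mul (h r (by omega)))
    rw [zero_mul, sub_zero] at hb
    refine hb.congr fun n => ?_
    rw [hrec (r + 1) n]
    simp [spectralLaw]

end Multigraph

theorem lemma4p2 {V D : ℕ → Type*} [∀ n, Fintype (V n)] [∀ n, DecidableEq (V n)]
    [∀ n, Nonempty (V n)] [∀ n, Finite (D n)]
    (G : ∀ n, Multigraph (V n) (D n)) (q : ℕ → ℕ) (hq : ∀ n, 1 ≤ q n)
    (hG : ∀ n, (G n).IsRegular (q n + 1))
    (hweak : Tendsto (fun n => (G n).spectralLaw (q n)) atTop (𝓝 semicircleLaw))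
    (m : ℕ) (hm : 0 < m) (hm_even : Even m) :
    List.TFAE [
      ∀ p : ℝ, p ∈ Set.Icc 1 (m : ℝ) →
        TendstoWasserstein p (fun n => (G n).spectralLaw (q n)) semicircleLaw,
      ∀ p : ℝ, p ∈ Set.Icc 1 (m : ℝ) →
        TendstoLpUnitInterval p (fun n => invDistFun ((G n).spectralLaw (q n)))
          (invDistFun semicircleLaw),
      Tendsto q atTop atTop ∧ ∀ r ∈ Finset.Icc 1 m,
        Tendsto (fun n => (q n : ℝ) ^ (-((r : ℝ) / 2)) *
          (((G n).numCircuits r : ℝ) / (Fintype.card (V n) : ℝ))) atTop (𝓝 0),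
      Tendsto q atTop atTop ∧ ∀ r ∈ Finset.Icc 1 m,
        Tendsto (fun n => (q n : ℝ) ^ (-((r : ℝ) / 2)) *
          (((G n).numClosedNBW r : ℝ) / (Fintype.card (V n) : ℝ))) atTop (𝓝 0)] := by

  have hμ (n : ℕ) : ∃ C, ∀ᵐ x ∂((G n).spectralLaw (q n) : Measure ℝ), |x| ≤ C :=
    Multigraph.bounded_spectralLaw G n
  have hν := Multigraph.bounded_semicircleLaw
  -- Length two must be available: it is what forces `q → ∞`.
  have hm2 : 2 ≤ m := by
    obtain ⟨k, rfl⟩ := hm_even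
    omega
  tfae_have 2 → 1 := fun h p hp => tendstoWasserstein_of_tendstoLpUnitInterval hμ hν hp.1 (h p hp)
  -- Convergence of the single `m`-th moment is the hub: the exponent `p = m` yields it, and it
  -- yields all of (ii).
  have hM : (∀ p : ℝ, p ∈ Set.Icc 1 (m : ℝ) →
      TendstoWasserstein p (fun n => (G n).spectralLaw (q n)) semicircleLaw) →
      Tendsto (fun n => ∫ x, x ^ m ∂((G n).spectralLaw (q n) : Measure ℝ)) atTop
        (𝓝 (∫ x, x ^ m ∂(semicircleLaw : Measure ℝ))) := fun h =>
    tendsto_integral_pow_of_tendsto_wassersteinDist hν hm hm_even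
      (h m ⟨by exact_mod_cast hm, le_rfl⟩).2.2
  have hM2 : Tendsto (fun n => ∫ x, x ^ m ∂((G n).spectralLaw (q n) : Measure ℝ)) atTop
        (𝓝 (∫ x, x ^ m ∂(semicircleLaw : Measure ℝ))) →
      ∀ p : ℝ, p ∈ Set.Icc 1 (m : ℝ) → TendstoLpUnitInterval p
        (fun n => invDistFun ((G n).spectralLaw (q n))) (invDistFun semicircleLaw) :=
    fun h p hp => tendstoLpUnitInterval_of_tendsto_integral_pow hweak hμ hν hm hm_even h hp.2
  tfae_have 1 → 2 := fun h => hM2 (hM h)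
  tfae_have 1 → 4 := by
    intro h
    refine Multigraph.tendsto_numClosedNBW_of_chebyshevS G hq hG hm2 fun j hj => ?_
    have h1 := tendstoIntegral_chebyshevS (m := m) hμ hν (fun k hk => ?_) j 0 hj
    · simpa using h1
    · simpa [TendstoIntegral] using tendsto_integral_pow_of_le hweak hμ hν hm_even (hM h) hk
  tfae_have 4 → 2 := by
    rintro ⟨hinf, h⟩
    -- Power `m` and index `0`: since `S_0 = 1`, this is the `m`-th moment.
    have h1 := tendstoIntegral_pow (m := m) hμ hν
      (Multigraph.tendstoIntegral_chebyshevS_of_numClosedNBW G hq hG hinf h) m 0 (by omega)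
    refine hM2 ?_
    simpa [TendstoIntegral] using h1
  tfae_have 3 ↔ 4 := and_congr_right (Multigraph.tendsto_numCircuits_iff G hq hG)
  tfae_finish
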